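/- **Setting.** Let $d\in\{2,3\}$, let $\Omega\subset\mathbb R^d$ be a bounded domain and let $\mathcal T$ be a finite face-to-face decomposition of $\Omega$ into closed $d$-simplices, $\overline\Omega=\bigcup_{K\in\mathcal T}K$, with set of $(d-1)$-dimensional faces $\mathcal F$. On $\mathbb R^{d\times d}$ let $P:Q$ be the Frobenius product and $|\cdot|$ the Frobenius norm. Let $\phi$ be a uniformly convex N-function, $\phi\in C^2((0,\infty))$, with indices $$1<r^-=\inf_{t>0}\frac{\phi''(t)t}{\phi'(t)}+1\le\sup_{t>0}\frac{\phi''(t)t}{\phi'(t)}+1=r^+<\infty ,$$ and let $\phi^*(t)=\sup_{s\ge0}(st-\phi(s))$. Let $\boldsymbol A\in C^0(\mathbb R^{d\times d},\mathbb R^{d\times d})\cap C^1(\mathbb R^{d\times d}\setminus\{0\},\mathbb R^{d\times d})$ with $\boldsymbol A(0)=0$ have $\phi$-structure with constants $C_0,C_1>0$: for all $P$, all $Q\ne0$ and all $i,j,k,l$, $$\sum_{i,j,k,l}\partial_{kl}A_{ij}(Q)P_{ij}P_{kl}\ge C_0\,\phi''(|Q|)|P|^2,\qquad |\partial_{kl}A_{ij}(Q)|\le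 C_1\,\phi''(|Q|).$$ Put $\boldsymbol F(Q)=\sqrt{\phi'(|Q|)|Q|}\,Q/|Q|$ (with $\boldsymbol F(0)=0$) and $\mathrm D v=\frac12(\nabla v+(\nabla v)^T)$. Let $W^{1,\phi}_0(\Omega)$ be the space of $\mathbb R^d$-valued Sobolev-Orlicz functions with zero boundary values, with norm $\|\nabla\cdot\|_\phi$ (Luxemburg norm), $W^{-1,\phi^*}(\Omega)$ its dual, and $L_0^{\phi^*}(\Omega)$ the space of scalar functions in $L^{\phi^*}(\Omega)$ with integral zero. Let $\mathbf{CR}$ be the space of element-wise affine $\mathbb R^d$-valued functions $v_h$ with $\int_F[v_h]=0$ for all $F\in\mathcal F$, where $[v_h]$ is the jump across an interior face and the trace on a boundary face; let $\widehat S^0_0$ be the space of element-wise constant scalar functions with integral zero over $\Omega$, let $\operatorname{div}_h$ be the element-wise divergence and $\mathbf Z_h=\{v_h\in\mathbf{CR}:\operatorname{div}_hv_h=0\}$. Let $\boldsymbol E:\mathbf{CR}\to W^{1,\infty}_0(\Omega)$ be a linear divergence-preserving smoothing operator: in each element, $\boldsymbol Ev_h=\mathcal Av_h+\mathcal Bv_h+\mathcal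 Cv_h$, where $\mathcal Av_h$ is the continuous piecewise affine function whose value at a vertex in $\Omega$ is a fixed convex combination of the values there of $v_h$ from the adjacent elements, and whose value at a vertex on $\partial\Omega$ is $0$; $\mathcal Bv_h$ is the combination of the face bubbles (the products of the $d$ barycentric coordinates of the vertices of a face) that has the same face integrals as $v_h-\mathcal Av_h$; and, on each $K\in\mathcal T$, $\mathcal Cv_h$ is an element bubble, that is, a continuous field on $K$ that vanishes on $\partial K$ and is polynomial on each simplex of the barycentric refinement of $K$, such that $\operatorname{div}\mathcal Cv_h=\operatorname{div}v_h-\operatorname{div}(\mathcal Av_h+\mathcal Bv_h)$ in each simplex of that refinement. **Theorem.** For given $r^\pm$, $C_0$, $C_1$ there is a constant $c$ depending only on them such that the following holds in every such setting. Let $f\in W^{-1,\phi^*}(\Omega)$ and let $(u,p)\in W^{1,\phi}_0(\Omega)\times L^{\phi^*}_0(\Omega)$ satisfy $$\int_\Omega\boldsymbol A(\mathrm Du):\mathrm Dv-\int_\Omega p\operatorname{div}v=\langle f,v\rangle\quad\forall v\in W^{1,\phi}_0(\Omega),\qquad \int_\Omega q\operatorname{div}u=0\quad\forall q\in L^{\phi^*}_0(\Omega).$$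 Let $(u_h,p_h)\in\mathbf{CR}\times\widehat S^0_0$ satisfy $$\int_\Omega\boldsymbol A(\mathrm D\boldsymbol Eu_h):\mathrm D\boldsymbol Ev_h-\int_\Omega p_h\operatorname{div}_hv_h=\langle f,\boldsymbol Ev_h\rangle\quad\forall v_h\in\mathbf{CR},\qquad \int_\Omega q_h\operatorname{div}_hu_h=0\quad\forall q_h\in\widehat S^0_0.$$ Then $$\|\boldsymbol F(\mathrm Du)-\boldsymbol F(\mathrm D\boldsymbol Eu_h)\|_{L^2(\Omega)}\le c\,\inf_{v_h\in\mathbf Z_h}\|\boldsymbol F(\mathrm Du)-\boldsymbol F(\mathrm D\boldsymbol Ev_h)\|_{L^2(\Omega)} .$$ -/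

import Mathlib

open MeasureTheory Set Filter Topology
open scoped ENNReal NNReal ContDiff

noncomputable section

namespace NonlinearStokes

/-- `ℝ^d` with the Euclidean norm. -/
abbrev Vec (d : ℕ) := EuclideanSpace ℝ (Fin d)

/-- `ℝ^{d×d}` with the Frobenius product as `inner ℝ` and the Frobenius norm as `‖·‖`;
the `(i,j)` entry of `Q` is `Q (i, j)`. -/
abbrev Mat (d : ℕ) := EuclideanSpace ℝ (Fin d × Fin d)

/-- The `j`-th unit vector. -/
def unitVec {d : ℕ} (j : Fin d) : Vec d := EuclideanSpace.single j 1

/-- The matrix whose only nonzero entry is a `1` at position `(k, l)`. -/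
def unitMat {d : ℕ} (k l : Fin d) : Mat d := EuclideanSpace.single (k, l) 1

/-- The symmetric part `(Q + Qᵀ) / 2`. -/
def symPart {d : ℕ} (Q : Mat d) : Mat d :=
  WithLp.toLp 2 fun p => (Q (p.1, p.2) + Q (p.2, p.1)) / 2

/-- The trace of a matrix. -/
def tr {d : ℕ} (Q : Mat d) : ℝ := ∑ i, Q (i, i)

/-! ### N-functions -/

/-- N-functions; only the values on `[0, ∞)` matter. -/
structure IsNFunction (φ : ℝ → ℝ) : Prop where
  continuousOn : ContinuousOn φ (Ici 0)
  convexOn : ConvexOn ℝ (Ici 0) φ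
  strictMonoOn : StrictMonoOn φ (Ici 0)
  map_zero : φ 0 = 0
  tendsto_zero : Tendsto (fun t => φ t / t) (𝓝[>] 0) (𝓝 0)
  tendsto_atTop : Tendsto (fun t => φ t / t) atTop atTop

/-- `φ` is a uniformly convex N-function, twice continuously differentiable on `(0, ∞)`, whose
indices of uniform convexity are exactly `rm` (the infimum) and `rp` (the supremum). -/
structure IsUniformlyConvexNFunction (φ : ℝ → ℝ) (rm rp : ℝ) : Prop where
  isNFunction : IsNFunction φ
  contDiffOn : ContDiffOn ℝ 2 φ (Ioi 0)
  one_lt : 1 < rm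
  isGLB : IsGLB ((fun t => deriv (deriv φ) t * t / deriv φ t + 1) '' Ioi 0) rm
  isLUB : IsLUB ((fun t => deriv (deriv φ) t * t / deriv φ t + 1) '' Ioi 0) rp

/-- The conjugate N-function `φ^*(t) = sup_{s ≥ 0} (s t - φ(s))`. -/
def conjugate (φ : ℝ → ℝ) (t : ℝ) : ℝ := sSup ((fun s => s * t - φ s) '' Ici 0)

/-! ### The nonlinear operator and the natural distance -/

/-- `A` has `φ`-structure with constants `C₀` and `C₁`. -/
structure HasPhiStructure {d : ℕ} (φ : ℝ → ℝ) (C₀ C₁ : ℝ) (A : Mat d → Mat d) : Prop where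
  continuous : Continuous A
  contDiffOn : ContDiffOn ℝ 1 A {0}ᶜ
  map_zero : A 0 = 0
  C₀_pos : 0 < C₀
  C₁_pos : 0 < C₁
  coercive : ∀ P Q : Mat d, Q ≠ 0 →
    C₀ * deriv (deriv φ) ‖Q‖ * ‖P‖ ^ 2 ≤
      ∑ i, ∑ j, ∑ k, ∑ l, fderiv ℝ A Q (unitMat k l) (i, j) * P (i, j) * P (k, l)
  bounded : ∀ Q : Mat d, Q ≠ 0 → ∀ i j k l,
    |fderiv ℝ A Q (unitMat k l) (i, j)| ≤ C₁ * deriv (deriv φ) ‖Q‖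

/-- `F(Q) = √(φ'(|Q|) |Q|) Q / |Q|`, with `F(0) = 0`. -/
def natF {d : ℕ} (φ : ℝ → ℝ) (Q : Mat d) : Mat d :=
  (√(deriv φ ‖Q‖ * ‖Q‖) / ‖Q‖) • Q

/-! ### Function spaces

Functions on `Ω` are represented by functions on the whole space whose values outside `Ω` are
irrelevant. -/

/-- `g ∈ L^φ(Ω)`. -/
def MemLPhi {d : ℕ} {X : Type*} [NormedAddCommGroup X] (φ : ℝ → ℝ) (Ω : Set (Vec d))
    (g : Vec d → X) : Prop :=
  AEStronglyMeasurable g (volume.restrict Ω) ∧ ∫⁻ x in Ω, ENNReal.ofReal (φ ‖g x‖) < ⊤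

/-- The Luxemburg norm `‖g‖_φ` on `Ω`. -/
def luxNorm {d : ℕ} {X : Type*} [NormedAddCommGroup X] (φ : ℝ → ℝ) (Ω : Set (Vec d))
    (g : Vec d → X) : ℝ :=
  sInf {s : ℝ | 0 < s ∧ ∫⁻ x in Ω, ENNReal.ofReal (φ (‖g x‖ / s)) ≤ 1}

/-- `q ∈ L^φ_0(Ω)`: scalar functions in `L^φ(Ω)` with integral zero. -/
def MemLPhiZeroMean {d : ℕ} (φ : ℝ → ℝ) (Ω : Set (Vec d)) (q : Vec d → ℝ) : Prop :=
  MemLPhi φ Ω q ∧ ∫ x in Ω, q x = 0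

/-- Smooth functions with compact support in `Ω`. -/
def IsTest {d : ℕ} {X : Type*} [NormedAddCommGroup X] [NormedSpace ℝ X] (Ω : Set (Vec d))
    (ψ : Vec d → X) : Prop :=
  ContDiff ℝ ∞ ψ ∧ HasCompactSupport ψ ∧ tsupport ψ ⊆ Ω

/-- The classical gradient `(∂_j v_i)_{ij}`. -/
def grad {d : ℕ} (v : Vec d → Vec d) (x : Vec d) : Mat d :=
  WithLp.toLp 2 fun p => fderiv ℝ v x (unitVec p.2) p.1

/-- `G` is a weak gradient of the vector field `v` in `Ω`. -/
def HasWeakGrad {d : ℕ} (Ω : Set (Vec d)) (v : Vec d → Vec d) (G : Vec d → Mat d) : Prop :=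
  LocallyIntegrableOn v Ω ∧ LocallyIntegrableOn G Ω ∧
    ∀ ψ : Vec d → ℝ, IsTest Ω ψ → ∀ i j : Fin d,
      ∫ x in Ω, v x i * fderiv ℝ ψ x (unitVec j) = -∫ x in Ω, G x (i, j) * ψ x

open scoped Classical in
/-- The weak gradient `∇v` in `Ω` (unique almost everywhere in an open set `Ω`). -/
def weakGrad {d : ℕ} (Ω : Set (Vec d)) (v : Vec d → Vec d) : Vec d → Mat d :=
  if h : ∃ G, HasWeakGrad Ω v G then h.choose else 0

/-- The symmetric gradient `Dv = (∇v + (∇v)ᵀ) / 2` in `Ω`. -/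
def symGrad {d : ℕ} (Ω : Set (Vec d)) (v : Vec d → Vec d) (x : Vec d) : Mat d :=
  symPart (weakGrad Ω v x)

/-- The divergence of `v` in `Ω`. -/
def weakDiv {d : ℕ} (Ω : Set (Vec d)) (v : Vec d → Vec d) (x : Vec d) : ℝ :=
  tr (weakGrad Ω v x)

/-- Zero boundary values: `v`, with weak gradient `G`, is a limit in `W^{1,1}(Ω)` of test fields,
that is, `v ∈ W^{1,1}_0(Ω)`. -/
def HasZeroTrace {d : ℕ} (Ω : Set (Vec d)) (v : Vec d → Vec d) (G : Vec d → Mat d) : Prop :=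
  ∀ ε : ℝ≥0∞, 0 < ε → ∃ ψ : Vec d → Vec d, IsTest Ω ψ ∧
    eLpNorm (fun x => v x - ψ x) 1 (volume.restrict Ω) +
      eLpNorm (fun x => G x - grad ψ x) 1 (volume.restrict Ω) < ε

/-- The vector-valued space `W^{1,φ}_0(Ω)`. -/
def W01Phi {d : ℕ} (φ : ℝ → ℝ) (Ω : Set (Vec d)) : Set (Vec d → Vec d) :=
  {v | ∃ G, HasWeakGrad Ω v G ∧ MemLPhi φ Ω v ∧ MemLPhi φ Ω G ∧ HasZeroTrace Ω v G}

theorem IsTest.add {d : ℕ} {X : Type*} [NormedAddCommGroup X] [NormedSpace ℝ X] {Ω : Set (Vec d)}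
    {ψ χ : Vec d → X} (hψ : IsTest Ω ψ) (hχ : IsTest Ω χ) : IsTest Ω (ψ + χ) :=
  ⟨hψ.1.add hχ.1, hψ.2.1.add hχ.2.1,
    (tsupport_add ψ χ).trans (union_subset hψ.2.2 hχ.2.2)⟩

theorem IsTest.const_smul {d : ℕ} {X : Type*} [NormedAddCommGroup X] [NormedSpace ℝ X]
    {Ω : Set (Vec d)} {ψ : Vec d → X} (hψ : IsTest Ω ψ) (a : ℝ) : IsTest Ω (a • ψ) :=
  ⟨hψ.1.const_smul a, hψ.2.1.mono fun x hx => by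
      simp only [Function.mem_support, Pi.smul_apply] at hx ⊢
      exact fun h => hx (by simp [h]),
    (closure_mono fun x hx => by
      simp only [Function.mem_support, Pi.smul_apply] at hx ⊢
      exact fun h => hx (by simp [h])).trans hψ.2.2⟩

theorem integrableOn_mul_test {d : ℕ} {Ω : Set (Vec d)} {ι : Type*} [Fintype ι]
    {g : Vec d → EuclideanSpace ℝ ι} (hg : LocallyIntegrableOn g Ω) {χ : Vec d → ℝ}
    (hχ : Continuous χ) (hc : HasCompactSupport χ) (hs : tsupport χ ⊆ Ω) (i : ι) :
    IntegrableOn (fun x => g x i * χ x) Ω := by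
  have h₁ : IntegrableOn g (tsupport χ) := hg.integrableOn_compact_subset hs hc
  have h₂ : IntegrableOn (fun x => g x i) (tsupport χ) :=
    (EuclideanSpace.proj (𝕜 := ℝ) i : EuclideanSpace ℝ ι →L[ℝ] ℝ).integrable_comp h₁
  have h₃ : IntegrableOn (fun x => g x i * χ x) (tsupport χ) :=
    h₂.mul_continuousOn hχ.continuousOn hc
  have h₄ : Function.support (fun x => g x i * χ x) ⊆ tsupport χ := fun x hx =>
    subset_tsupport _ fun h => hx (by simp [h])
  exact ((integrableOn_iff_integrable_of_support_subset h₄).1 h₃).integrableOn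

theorem integrableOn_mul_test_deriv {d : ℕ} {Ω : Set (Vec d)} {ι : Type*} [Fintype ι]
    {g : Vec d → EuclideanSpace ℝ ι} (hg : LocallyIntegrableOn g Ω) {ψ : Vec d → ℝ}
    (hψ : IsTest Ω ψ) (i : ι) (j : Fin d) :
    IntegrableOn (fun x => g x i * fderiv ℝ ψ x (unitVec j)) Ω :=
  integrableOn_mul_test hg ((hψ.1.continuous_fderiv (by simp)).clm_apply continuous_const)
    (hψ.2.1.fderiv_apply ℝ _) ((tsupport_fderiv_apply_subset ℝ _).trans hψ.2.2) i

theorem HasWeakGrad.add {d : ℕ} {Ω : Set (Vec d)} {v w : Vec d → Vec d} {G H : Vec d → Mat d}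
    (hv : HasWeakGrad Ω v G) (hw : HasWeakGrad Ω w H) : HasWeakGrad Ω (v + w) (G + H) := by
  refine ⟨hv.1.add hw.1, hv.2.1.add hw.2.1, fun ψ hψ i j => ?_⟩
  simp only [Pi.add_apply, PiLp.add_apply, add_mul]
  rw [integral_add (integrableOn_mul_test_deriv hv.1 hψ i j)
      (integrableOn_mul_test_deriv hw.1 hψ i j),
    integral_add (integrableOn_mul_test hv.2.1 hψ.1.continuous hψ.2.1 hψ.2.2 (i, j))
      (integrableOn_mul_test hw.2.1 hψ.1.continuous hψ.2.1 hψ.2.2 (i, j)),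
    hv.2.2 ψ hψ i j, hw.2.2 ψ hψ i j, neg_add]

theorem HasWeakGrad.const_smul {d : ℕ} {Ω : Set (Vec d)} {v : Vec d → Vec d} {G : Vec d → Mat d}
    (hv : HasWeakGrad Ω v G) (a : ℝ) : HasWeakGrad Ω (a • v) (a • G) := by
  refine ⟨hv.1.smul a, hv.2.1.smul a, fun ψ hψ i j => ?_⟩
  simp only [Pi.smul_apply, PiLp.smul_apply, smul_eq_mul, mul_assoc]
  rw [integral_const_mul, integral_const_mul, hv.2.2 ψ hψ i j, mul_neg]

theorem grad_add {d : ℕ} {v w : Vec d → Vec d} (hv : Differentiable ℝ v)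
    (hw : Differentiable ℝ w) : grad (v + w) = grad v + grad w := by
  funext x
  ext p
  simp [grad, fderiv_add (hv x) (hw x)]

theorem grad_const_smul {d : ℕ} {v : Vec d → Vec d} (hv : Differentiable ℝ v) (a : ℝ) :
    grad (a • v) = a • grad v := by
  funext x
  ext p
  simp [grad, fderiv_const_smul (hv x)]

theorem continuous_grad {d : ℕ} {v : Vec d → Vec d} (hv : ContDiff ℝ ∞ v) :
    Continuous (grad v) := by
  refine (PiLp.continuous_toLp 2 _).comp (continuous_pi fun p => ?_)
  exact (EuclideanSpace.proj (𝕜 := ℝ) p.1 : Vec d →L[ℝ] ℝ).continuous.comp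
    ((hv.continuous_fderiv (by simp)).clm_apply continuous_const)

theorem HasZeroTrace.add {d : ℕ} {Ω : Set (Vec d)} {v w : Vec d → Vec d} {G H : Vec d → Mat d}
    (hv : HasZeroTrace Ω v G) (hw : HasZeroTrace Ω w H)
    (mv : AEStronglyMeasurable v (volume.restrict Ω))
    (mG : AEStronglyMeasurable G (volume.restrict Ω)) : HasZeroTrace Ω (v + w) (G + H) := by
  intro ε hε
  obtain ⟨ψ, hψ, h₁⟩ := hv (ε / 2) (ENNReal.half_pos hε.ne')
  obtain ⟨χ, hχ, h₂⟩ := hw (ε / 2) (ENNReal.half_pos hε.ne')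
  refine ⟨ψ + χ, hψ.add hχ, ?_⟩
  have e₁ : (fun x => (v + w) x - (ψ + χ) x) = (fun x => v x - ψ x) + fun x => w x - χ x := by
    funext x
    simp only [Pi.add_apply]
    abel
  have e₂ : (fun x => (G + H) x - grad (ψ + χ) x) =
      (fun x => G x - grad ψ x) + fun x => H x - grad χ x := by
    rw [grad_add (hψ.1.differentiable (by simp)) (hχ.1.differentiable (by simp))]
    funext x
    simp only [Pi.add_apply]
    abel
  have add_le : ∀ {X : Type} [NormedAddCommGroup X] (a b : Vec d → X),
      AEStronglyMeasurable a (volume.restrict Ω) →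
      eLpNorm (a + b) 1 (volume.restrict Ω) ≤
        eLpNorm a 1 (volume.restrict Ω) + eLpNorm b 1 (volume.restrict Ω) := by
    intro X _ a b ha
    simp only [eLpNorm_one_eq_lintegral_enorm, Pi.add_apply]
    rw [← lintegral_add_left' ha.enorm]
    exact lintegral_mono fun x => enorm_add_le _ _
  rw [e₁, e₂]
  refine (add_le_add
    (add_le _ _ (mv.sub hψ.1.continuous.aestronglyMeasurable))
    (add_le _ _ (mG.sub (continuous_grad hψ.1).aestronglyMeasurable))).trans_lt ?_
  rw [add_add_add_comm]
  exact (ENNReal.add_lt_add h₁ h₂).trans_eq (ENNReal.add_halves ε)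

theorem HasZeroTrace.const_smul {d : ℕ} {Ω : Set (Vec d)} {v : Vec d → Vec d} {G : Vec d → Mat d}
    (hv : HasZeroTrace Ω v G) (a : ℝ) : HasZeroTrace Ω (a • v) (a • G) := by
  intro ε hε
  by_cases ha : a = 0
  · refine ⟨0, ⟨contDiff_const, HasCompactSupport.zero, by simp⟩, ?_⟩
    have : grad (0 : Vec d → Vec d) = 0 := by
      funext x
      ext p
      simp [grad]
    simpa [this, ha] using hε
  have hpos : ‖a‖ₑ ≠ 0 := by simpa using ha
  obtain ⟨ψ, hψ, h⟩ := hv (ε / ‖a‖ₑ) (ENNReal.div_pos hε.ne' enorm_ne_top)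
  refine ⟨a • ψ, hψ.const_smul a, ?_⟩
  have e₁ : (fun x => (a • v) x - (a • ψ) x) = a • fun x => v x - ψ x := by
    funext x
    simp only [Pi.smul_apply, smul_sub]
  have e₂ : (fun x => (a • G) x - grad (a • ψ) x) = a • fun x => G x - grad ψ x := by
    rw [grad_const_smul (hψ.1.differentiable (by simp))]
    funext x
    simp only [Pi.smul_apply, smul_sub]
  rw [e₁, e₂, eLpNorm_const_smul, eLpNorm_const_smul, ← mul_add, mul_comm]
  exact (ENNReal.lt_div_iff_mul_lt (Or.inl hpos) (Or.inl enorm_ne_top)).1 h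

/-- The vector-valued space `W^{1,∞}_0(Ω)`. -/
def W01Infty {d : ℕ} (Ω : Set (Vec d)) : Submodule ℝ (Vec d → Vec d) where
  carrier := {v | ∃ G, HasWeakGrad Ω v G ∧ MemLp v ⊤ (volume.restrict Ω) ∧
    MemLp G ⊤ (volume.restrict Ω) ∧ HasZeroTrace Ω v G}
  zero_mem' := by
    refine ⟨0, ⟨locallyIntegrableOn_zero, locallyIntegrableOn_zero, by simp⟩,
      MemLp.zero, MemLp.zero, fun ε hε => ⟨0, ⟨contDiff_const, HasCompactSupport.zero, by simp⟩, ?_⟩⟩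
    have : grad (0 : Vec d → Vec d) = 0 := by
      funext x
      ext p
      simp [grad]
    simpa [this] using hε
  add_mem' := by
    rintro v w ⟨G, h₁, h₂, h₃, h₄⟩ ⟨H, k₁, k₂, k₃, k₄⟩
    exact ⟨G + H, h₁.add k₁, h₂.add k₂, h₃.add k₃, h₄.add k₄ h₂.1 h₃.1⟩
  smul_mem' := by
    rintro a v ⟨G, h₁, h₂, h₃, h₄⟩
    exact ⟨a • G, h₁.const_smul a, h₂.const_smul a, h₃.const_smul a, h₄.const_smul a⟩

/-- `f` is an element of the dual space `W^{-1,φ^*}(Ω)` of `W^{1,φ}_0(Ω)`, the latter with the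
norm `‖∇·‖_φ`. Only the values of `f` on `W^{1,φ}_0(Ω)` matter. -/
structure IsDualFunctional {d : ℕ} (φ : ℝ → ℝ) (Ω : Set (Vec d)) (f : (Vec d → Vec d) → ℝ) :
    Prop where
  map_add : ∀ v ∈ W01Phi φ Ω, ∀ w ∈ W01Phi φ Ω, f (v + w) = f v + f w
  map_smul : ∀ (a : ℝ), ∀ v ∈ W01Phi φ Ω, f (a • v) = a * f v
  bounded : ∃ M : ℝ, ∀ v ∈ W01Phi φ Ω, |f v| ≤ M * luxNorm φ Ω (weakGrad Ω v)

/-- `(u, p) ∈ W^{1,φ}_0(Ω) × L^{φ^*}_0(Ω)` is a weak solution of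
`-div A(Du) + ∇p = f`, `div u = 0` in `Ω`, `u = 0` on `∂Ω`. -/
structure IsWeakSolution {d : ℕ} (φ : ℝ → ℝ) (A : Mat d → Mat d) (Ω : Set (Vec d))
    (f : (Vec d → Vec d) → ℝ) (u : Vec d → Vec d) (p : Vec d → ℝ) : Prop where
  velocity_mem : u ∈ W01Phi φ Ω
  pressure_mem : MemLPhiZeroMean (conjugate φ) Ω p
  momentum : ∀ v ∈ W01Phi φ Ω,
    (∫ x in Ω, inner ℝ (A (symGrad Ω u x)) (symGrad Ω v x)) - (∫ x in Ω, p x * weakDiv Ω v x) =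
      f v
  mass : ∀ q, MemLPhiZeroMean (conjugate φ) Ω q → ∫ x in Ω, q x * weakDiv Ω u x = 0

/-! ### Meshes -/

/-- A finite face-to-face mesh of `d`-simplices in `ℝ^d`, given by the simplicial complex of its
elements and all their subsimplices; simplices are represented by their vertex sets. -/
structure Mesh (d : ℕ) where
  complex : Geometry.SimplicialComplex ℝ (Vec d)
  finite : complex.faces.Finite
  pure : ∀ s ∈ complex.faces, ∃ K ∈ complex.faces, s ⊆ K ∧ K.card = d + 1

/-- The closed simplex with the given vertices. -/
def hull {d : ℕ} (s : Finset (Vec d)) : Set (Vec d) := convexHull ℝ (s : Set (Vec d))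

namespace Mesh

variable {d : ℕ}

/-- The elements of the mesh: its `d`-simplices. -/
def elements (T : Mesh d) : Finset (Finset (Vec d)) :=
  T.finite.toFinset.filter fun K => K.card = d + 1

/-- The faces of the mesh: its `(d-1)`-simplices. -/
def sides (T : Mesh d) : Finset (Finset (Vec d)) :=
  T.finite.toFinset.filter fun F => F.card = d

/-- `T` is a decomposition of the bounded domain `Ω`. -/
structure IsMeshOf (T : Mesh d) (Ω : Set (Vec d)) : Prop where
  isOpen : IsOpen Ω
  isConnected : IsConnected Ω
  isBounded : Bornology.IsBounded Ω
  closure_eq : closure Ω = ⋃ K ∈ T.elements, hull K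

/-- The vertices of an element form an affine basis. -/
def elementBasis (T : Mesh d) (K : T.elements) : AffineBasis K.1 ℝ (Vec d) where
  toFun := (↑)
  ind' := T.complex.indep (by
    have := K.2
    simp only [elements, Finset.mem_filter, Set.Finite.mem_toFinset] at this
    exact this.1)
  tot' := by
    have := K.2
    simp only [elements, Finset.mem_filter, Set.Finite.mem_toFinset] at this
    rw [(T.complex.indep this.1).affineSpan_eq_top_iff_card_eq_finrank_add_one]
    simp [this.2]

open scoped Classical in
/-- The barycentric coordinate of the element `K` that belongs to its vertex `z`. -/
def bary (T : Mesh d) (K : T.elements) (z : Vec d) : Vec d →ᵃ[ℝ] ℝ :=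
  if h : z ∈ K.1 then (T.elementBasis K).coord ⟨z, h⟩ else 0

/-- The piecewise constant function in `S^0_0` with value `g K` in `K`. -/
def pw (T : Mesh d) (g : T.elements → ℝ) (x : Vec d) : ℝ :=
  ∑ K : T.elements, (interior (hull K.1)).indicator (fun _ => g K) x

/-! ### The Crouzeix-Raviart space -/

/-- Piecewise affine vector fields `(S^0_1)^d`, given by their restrictions to the elements. -/
abbrev BrokenP1 (T : Mesh d) := T.elements → (Vec d →ᵃ[ℝ] Vec d)

end Mesh

/-- The integral over a face with respect to the `(d-1)`-dimensional Hausdorff measure. -/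
def faceIntegral {d : ℕ} {X : Type*} [NormedAddCommGroup X] [NormedSpace ℝ X]
    (F : Finset (Vec d)) (g : Vec d → X) : X :=
  ∫ x in hull F, g x ∂(Measure.hausdorffMeasure ((d : ℝ) - 1))

theorem hausdorffMeasure_hull_lt_top {d : ℕ} (F : Finset (Vec d)) (hF : F.card = d) :
    Measure.hausdorffMeasure ((d : ℝ) - 1) (hull F) < ⊤ := by
  rcases F.eq_empty_or_nonempty with rfl | hne
  · simp [hull]
  obtain ⟨n, hn⟩ : ∃ n, F.card = n + 1 := ⟨F.card - 1, by have := hne.card_pos; omega⟩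
  let e := F.equivFinOfCardEq hn
  let z : Fin (n + 1) → Vec d := fun i => (e.symm i).1
  let L : (Fin n → ℝ) →L[ℝ] Vec d :=
    ∑ i : Fin n, (ContinuousLinearMap.proj (R := ℝ) (φ := fun _ : Fin n => ℝ) i).smulRight
      (z i.succ - z 0)
  have hsub : hull F ⊆ (fun y => z 0 + L y) '' Icc (0 : Fin n → ℝ) 1 := by
    intro x hx
    obtain ⟨w, hw₀, hw₁, hwx⟩ := Finset.mem_convexHull'.1 hx
    have hsum : ∀ {X : Type} [AddCommMonoid X] (g : Vec d → X),
        ∑ y ∈ F, g y = ∑ i : Fin (n + 1), g (z i) := by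
      intro X _ g
      rw [← Finset.sum_coe_sort F g]
      exact (Equiv.sum_comp e.symm (fun y : F => g y.1)).symm
    have hmem : ∀ i, z i ∈ F := fun i => (e.symm i).2
    refine ⟨fun i => w (z i.succ), ⟨fun i => hw₀ _ (hmem _), fun i => ?_⟩, ?_⟩
    · exact (Finset.single_le_sum hw₀ (hmem _)).trans_eq hw₁
    · rw [hsum, Fin.sum_univ_succ] at hw₁ hwx
      have h0 : w (z 0) = 1 - ∑ i : Fin n, w (z i.succ) := by linarith
      rw [← hwx, h0]
      simp only [L, _root_.sum_apply, ContinuousLinearMap.smulRight_apply,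
        ContinuousLinearMap.proj_apply, smul_sub, Finset.sum_sub_distrib, sub_smul, one_smul,
        Finset.sum_smul]
      abel
  have hL : LipschitzOnWith (0 + ‖L‖₊) (fun y => z 0 + L y) (Icc (0 : Fin n → ℝ) 1) :=
    ((LipschitzWith.const (z 0)).add L.lipschitz).lipschitzOnWith
  have hd : (d : ℝ) - 1 = (Fintype.card (Fin n) : ℝ) := by
    rw [Fintype.card_fin, ← hF, hn]
    push_cast
    ring
  rw [hd]
  refine (measure_mono hsub).trans_lt ((hL.hausdorffMeasure_image_le (by positivity)).trans_lt ?_)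
  rw [hausdorffMeasure_pi_real]
  exact ENNReal.mul_lt_top (ENNReal.rpow_lt_top_of_nonneg (by positivity) ENNReal.coe_ne_top)
    isCompact_Icc.measure_lt_top

theorem integrableOn_face {d : ℕ} (F : Finset (Vec d)) (hF : F.card = d)
    (g : Vec d →ᵃ[ℝ] Vec d) :
    IntegrableOn g (hull F) (Measure.hausdorffMeasure ((d : ℝ) - 1)) := by
  have hg : Continuous g := g.continuous_of_finiteDimensional
  have hc : IsCompact (hull F) := F.finite_toSet.isCompact_convexHull ℝ
  have : IsFiniteMeasure ((Measure.hausdorffMeasure ((d : ℝ) - 1)).restrict (hull F)) :=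
    ⟨by simpa using hausdorffMeasure_hull_lt_top F hF⟩
  obtain ⟨M, hM⟩ := hc.exists_bound_of_continuousOn hg.continuousOn
  exact Integrable.of_bound hg.aestronglyMeasurable M
    ((ae_restrict_iff' hc.measurableSet).2 (Eventually.of_forall hM))

namespace Mesh

variable {d : ℕ}

/-- The Crouzeix-Raviart space: the face mean values of jumps vanish. A face is a boundary face if
it lies on `∂Ω`, where the jump is the trace, and an interior face otherwise. -/
def CR (T : Mesh d) (Ω : Set (Vec d)) : Submodule ℝ T.BrokenP1 where
  carrier := {v | ∀ F ∈ T.sides,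
    (¬ hull F ⊆ frontier Ω → ∀ K₁ K₂ : T.elements, F ⊆ K₁.1 → F ⊆ K₂.1 →
      faceIntegral F (fun x => v K₁ x - v K₂ x) = 0) ∧
    (hull F ⊆ frontier Ω → ∀ K : T.elements, F ⊆ K.1 → faceIntegral F (fun x => v K x) = 0)}
  zero_mem' := by
    intro F _
    simp [faceIntegral]
  add_mem' := by
    intro v w hv hw F hF
    have hc : F.card = d := by
      simp only [sides, Finset.mem_filter] at hF
      exact hF.2
    refine ⟨fun hi K₁ K₂ h₁ h₂ => ?_, fun hb K h => ?_⟩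
    · have e : (fun x => (v + w) K₁ x - (v + w) K₂ x) =
          fun x => (v K₁ - v K₂) x + (w K₁ - w K₂) x := by
        funext x
        simp only [Pi.add_apply, AffineMap.coe_add, AffineMap.coe_sub, Pi.sub_apply]
        abel
      have hv' := (hv F hF).1 hi K₁ K₂ h₁ h₂
      have hw' := (hw F hF).1 hi K₁ K₂ h₁ h₂
      rw [e, faceIntegral, integral_add (integrableOn_face F hc _) (integrableOn_face F hc _)]
      simp only [faceIntegral] at hv' hw'
      simp only [AffineMap.coe_sub, Pi.sub_apply, hv', hw', add_zero]
    · have hv' := (hv F hF).2 hb K h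
      have hw' := (hw F hF).2 hb K h
      simp only [faceIntegral] at hv' hw' ⊢
      simp only [Pi.add_apply, AffineMap.coe_add]
      rw [integral_add (integrableOn_face F hc _) (integrableOn_face F hc _), hv', hw', add_zero]
  smul_mem' := by
    intro a v hv F hF
    refine ⟨fun hi K₁ K₂ h₁ h₂ => ?_, fun hb K h => ?_⟩
    · have hv' := (hv F hF).1 hi K₁ K₂ h₁ h₂
      simp only [faceIntegral] at hv' ⊢
      simp only [Pi.smul_apply, AffineMap.coe_smul, ← smul_sub]
      rw [integral_smul, hv', smul_zero]
    · have hv' := (hv F hF).2 hb K h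
      simp only [faceIntegral] at hv' ⊢
      simp only [Pi.smul_apply, AffineMap.coe_smul]
      rw [integral_smul, hv', smul_zero]

/-- The element-wise divergence of a piecewise affine field; it is constant in each element. -/
def divh (T : Mesh d) (v : T.BrokenP1) (K : T.elements) : ℝ :=
  ∑ i, (v K).linear (unitVec i) i

/-- The element-wise divergence-free Crouzeix-Raviart functions. -/
def Zh (T : Mesh d) (Ω : Set (Vec d)) : Set (T.CR Ω) :=
  {v | ∀ K, T.divh v.1 K = 0}

/-- Piecewise constant functions with integral zero over `Ω`. -/
def S00hat (T : Mesh d) (Ω : Set (Vec d)) : Set (T.elements → ℝ) :=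
  {q | ∫ x in Ω, T.pw q x = 0}

/-! ### The smoothing operator `E = A + B + C` -/

/-- Weights for nodal averaging: at each vertex inside `Ω`, a convex combination of the adjacent
elements. -/
def IsAveragingWeight (T : Mesh d) (Ω : Set (Vec d)) (α : Vec d → T.elements → ℝ) : Prop :=
  ∀ z ∈ Ω, ∀ K₀ : T.elements, z ∈ K₀.1 →
    (∀ K, 0 ≤ α z K) ∧ (∀ K : T.elements, z ∉ K.1 → α z K = 0) ∧ ∑ K, α z K = 1

open scoped Classical in
/-- The averaged nodal value of `v` at the vertex `z`; it is zero for vertices on `∂Ω`. -/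
def nodalValue (T : Mesh d) (Ω : Set (Vec d)) (α : Vec d → T.elements → ℝ) (v : T.BrokenP1)
    (z : Vec d) : Vec d :=
  if z ∈ Ω then ∑ K, α z K • v K z else 0

/-- The averaging operator into continuous piecewise affine fields, in the element `K`. -/
def averaging (T : Mesh d) (Ω : Set (Vec d)) (α : Vec d → T.elements → ℝ) (v : T.BrokenP1)
    (K : T.elements) (x : Vec d) : Vec d :=
  ∑ z ∈ K.1, T.bary K z x • T.nodalValue Ω α v z

/-- The bubble of the face `F`, in the element `K ⊇ F`. -/
def faceBubble (T : Mesh d) (F : Finset (Vec d)) (K : T.elements) (x : Vec d) : ℝ :=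
  ∏ z ∈ F, T.bary K z x

/-- The combination of face bubbles, in the element `K`, that has the same integral as `v - Av`
over each face of `K`. -/
def faceCorrection (T : Mesh d) (Ω : Set (Vec d)) (α : Vec d → T.elements → ℝ) (v : T.BrokenP1)
    (K : T.elements) (x : Vec d) : Vec d :=
  ∑ F ∈ K.1.powersetCard d, T.faceBubble F K x •
    ((faceIntegral F (T.faceBubble F K))⁻¹ •
      faceIntegral F fun y => v K y - T.averaging Ω α v K y)

/-- The subsimplex of `K` spanned by the barycentre of `K` and the vertices of `K` other than `z`;
it consists of the points of `K` at which the barycentric coordinate of `z` is the smallest. These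
sets, for the vertices `z` of `K`, form the barycentric refinement of `K`. -/
def subElement (T : Mesh d) (K : T.elements) (z : Vec d) : Set (Vec d) :=
  {x ∈ hull K.1 | ∀ y ∈ K.1, T.bary K z x ≤ T.bary K y x}

/-- Element bubbles: continuous fields on `K` that vanish on `∂K` and are polynomial on each
simplex of the barycentric refinement of `K`. -/
def IsElementBubble (T : Mesh d) (K : T.elements) (w : Vec d → Vec d) : Prop :=
  ContinuousOn w (hull K.1) ∧ (∀ x ∈ frontier (hull K.1), w x = 0) ∧
    ∀ z ∈ K.1, ∀ i : Fin d, ∃ P : MvPolynomial (Fin d) ℝ,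
      ∀ x ∈ T.subElement K z, w x i = MvPolynomial.eval (fun j => x j) P

/-- `w` solves the local problem for the element bubble correction in `K`: it is an element bubble
and, in each simplex of the barycentric refinement of `K`, `div w = div v - div (Av + Bv)`. -/
structure IsElementCorrection (T : Mesh d) (Ω : Set (Vec d)) (α : Vec d → T.elements → ℝ)
    (v : T.BrokenP1) (K : T.elements) (w : Vec d → Vec d) : Prop where
  isElementBubble : T.IsElementBubble K w
  div_eq : ∀ z ∈ K.1, ∀ x ∈ interior (T.subElement K z),
    tr (grad w x) = T.divh v K -
      tr (grad (fun y => T.averaging Ω α v K y + T.faceCorrection Ω α v K y) x)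

/-- `E : CR → W^{1,∞}_0(Ω)` is the divergence-preserving smoothing operator: in each element `Ev`
is the sum of the nodal average of `v`, the face bubble correction and an element bubble
correction. -/
def IsSmoothingOperator (T : Mesh d) (Ω : Set (Vec d)) (E : T.CR Ω →ₗ[ℝ] W01Infty Ω) : Prop :=
  ∃ α, T.IsAveragingWeight Ω α ∧ ∀ (v : T.CR Ω) (K : T.elements),
    ∃ w, T.IsElementCorrection Ω α v.1 K w ∧ ∀ x ∈ hull K.1,
      (E v).1 x = T.averaging Ω α v.1 K x + T.faceCorrection Ω α v.1 K x + w x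

/-- `(u_h, p_h)` is a discrete solution: `p_h` has mean value zero and
`∫ A(D E u_h) : D E v_h - ∫ p_h div_h v_h = ⟨f, E v_h⟩` for all `v_h`, and
`∫ q_h div_h u_h = 0` for all `q_h`. -/
structure IsDiscreteSolution (T : Mesh d) (Ω : Set (Vec d)) (A : Mat d → Mat d)
    (E : T.CR Ω →ₗ[ℝ] W01Infty Ω) (f : (Vec d → Vec d) → ℝ)
    (uh : T.CR Ω) (ph : T.elements → ℝ) : Prop where
  pressure_mem : ph ∈ T.S00hat Ω
  momentum : ∀ vh : T.CR Ω,
    (∫ x in Ω, inner ℝ (A (symGrad Ω (E uh).1 x)) (symGrad Ω (E vh).1 x)) -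
      (∫ x in Ω, T.pw ph x * T.pw (T.divh vh.1) x) = f (E vh).1
  mass : ∀ qh ∈ T.S00hat Ω, ∫ x in Ω, T.pw qh x * T.pw (T.divh uh.1) x = 0

end Mesh

/-- The natural distance `‖F(Du) - F(Dv)‖_2` in `Ω`. -/
def natDist {d : ℕ} (φ : ℝ → ℝ) (Ω : Set (Vec d)) (u v : Vec d → Vec d) : ℝ≥0∞ :=
  eLpNorm (fun x => natF φ (symGrad Ω u x) - natF φ (symGrad Ω v x)) 2 (volume.restrict Ω)

end NonlinearStokes

end

noncomputable section

namespace NonlinearStokes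

/-! ### Functions with power-like growth -/

/-! Write `h` for `φ'`. The index bounds say that `t h'(t) / h(t)` stays between `rm - 1` and `rp -
1`, which gives power-like growth and a doubling property with constants depending on the indices
only. Integrating the structure conditions along segments shows that `(A P - A Q) : (P - Q)` is
bounded below, and `|A P - A Q| |P - Q|` above, by multiples of `h(|P| + |Q|) / (|P| + |Q|) |P -
Q|²` (`HasStructure.lower_bound`, `HasStructure.upper_bound`). The map `F` is itself a radial
operator built from `√(t h(t))`, so the same two bounds make `|F P - F Q|²` comparable to this
quantity (`natural_distance_equiv`). Hence `A` is monotone with respect to the natural distance and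
satisfies a Young type inequality (`monotone_and_young`).

The second ingredient is that `div E v_h = div_h v_h` almost everywhere
(`Mesh.IsSmoothingOperator.weakDiv_ae_eq`). Thus `E` maps `Z_h` to conforming, exactly
divergence-free fields. Testing the continuous equation with `E w_h` and the discrete one with `w_h`
in `Z_h` removes both pressures and leaves the same right-hand side (`galerkin_orthogonality`).

With `w_h = u_h - v_h`, orthogonality replaces `Du - DEu_h` by `Du - DEv_h` in the monotone term,
and Young's inequality absorbs half of that term. No stability bound for `E`, no inf-sup condition
and no Korn inequality enter, so neither the mesh nor `Ω` affects the constant. -/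

/-- `h` is positive on `(0, ∞)` with derivative `h'`, and `t h'(t) / h(t)` lies in `[a, b]`. -/
structure IsPowerLike (h h' : ℝ → ℝ) (a b : ℝ) : Prop where
  a_pos : 0 < a
  hasDerivAt : ∀ t, 0 < t → HasDerivAt h (h' t) t
  pos : ∀ t, 0 < t → 0 < h t
  lower : ∀ t, 0 < t → a * h t ≤ h' t * t
  upper : ∀ t, 0 < t → h' t * t ≤ b * h t

namespace IsPowerLike

variable {h h' : ℝ → ℝ} {a b : ℝ}

theorem le_index (H : IsPowerLike h h' a b) : a ≤ b :=
  le_of_mul_le_mul_right ((H.lower 1 one_pos).trans (H.upper 1 one_pos)) (H.pos 1 one_pos)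

theorem b_pos (H : IsPowerLike h h' a b) : 0 < b := H.a_pos.trans_le H.le_index

theorem deriv_pos (H : IsPowerLike h h' a b) {t : ℝ} (ht : 0 < t) : 0 < h' t :=
  pos_of_mul_pos_left ((mul_pos H.a_pos (H.pos t ht)).trans_le (H.lower t ht)) ht.le

/-- The derivative has the sign of `h' t * t - e * h t`, so the index bounds make the product
monotone for `e = a` and antitone for `e = b`. -/
theorem mul_rpow_hasDerivAt (H : IsPowerLike h h' a b) (e : ℝ) {t : ℝ} (ht : 0 < t) :
    HasDerivAt (fun t => h t * t ^ (-e)) ((h' t * t - e * h t) * t ^ (-e - 1)) t := by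
  have h₁ := (H.hasDerivAt t ht).mul (Real.hasDerivAt_rpow_const (p := -e) (Or.inl ht.ne'))
  refine h₁.congr_deriv ?_
  rw [show t ^ (-e) = t ^ (-e - 1) * t by
    rw [← Real.rpow_add_one ht.ne']; ring_nf]
  ring

theorem monotoneOn (H : IsPowerLike h h' a b) : MonotoneOn h (Ioi 0) := by
  refine monotoneOn_of_deriv_nonneg (convex_Ioi 0)
    (fun t ht => (H.hasDerivAt t ht).continuousAt.continuousWithinAt) ?_ ?_
  · rw [interior_Ioi]
    exact fun t ht => (H.hasDerivAt t ht).differentiableAt.differentiableWithinAt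
  · rw [interior_Ioi]
    intro t ht
    rw [(H.hasDerivAt t ht).deriv]
    exact (H.deriv_pos ht).le

theorem mul_rpow_monotoneOn (H : IsPowerLike h h' a b) :
    MonotoneOn (fun t => h t * t ^ (-a)) (Ioi 0) := by
  refine monotoneOn_of_deriv_nonneg (convex_Ioi 0)
    (fun t ht => (H.mul_rpow_hasDerivAt a ht).continuousAt.continuousWithinAt) ?_ ?_
  · rw [interior_Ioi]
    exact fun t ht => (H.mul_rpow_hasDerivAt a ht).differentiableAt.differentiableWithinAt
  · rw [interior_Ioi]
    intro t ht
    rw [(H.mul_rpow_hasDerivAt a ht).deriv]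
    exact mul_nonneg (sub_nonneg.2 (H.lower t ht)) (Real.rpow_nonneg (le_of_lt ht) _)

theorem mul_rpow_antitoneOn (H : IsPowerLike h h' a b) :
    AntitoneOn (fun t => h t * t ^ (-b)) (Ioi 0) := by
  refine antitoneOn_of_deriv_nonpos (convex_Ioi 0)
    (fun t ht => (H.mul_rpow_hasDerivAt b ht).continuousAt.continuousWithinAt) ?_ ?_
  · rw [interior_Ioi]
    exact fun t ht => (H.mul_rpow_hasDerivAt b ht).differentiableAt.differentiableWithinAt
  · rw [interior_Ioi]
    intro t ht
    rw [(H.mul_rpow_hasDerivAt b ht).deriv]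
    exact mul_nonpos_of_nonpos_of_nonneg (sub_nonpos.2 (H.upper t ht))
      (Real.rpow_nonneg (le_of_lt ht) _)

/-- The doubling property: the quotient `h t / t ^ b` is antitone. -/
theorem le_mul (H : IsPowerLike h h' a b) {l t : ℝ} (hl : 1 ≤ l) (ht : 0 < t) :
    h (l * t) ≤ l ^ b * h t := by
  have hl0 : 0 < l := one_pos.trans_le hl
  have h₁ := H.mul_rpow_antitoneOn (mem_Ioi.2 ht) (mem_Ioi.2 (mul_pos hl0 ht))
    (le_mul_of_one_le_left ht.le hl)
  simp only [Real.mul_rpow hl0.le ht.le, Real.rpow_neg hl0.le, Real.rpow_neg ht.le] at h₁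
  have p₁ := Real.rpow_pos_of_pos hl0 b
  have p₂ := Real.rpow_pos_of_pos ht b
  have e : h (l * t) * ((l ^ b)⁻¹ * (t ^ b)⁻¹) = h (l * t) / l ^ b / t ^ b := by
    field_simp
  rw [e, ← div_eq_mul_inv, div_le_div_iff_of_pos_right p₂, div_le_iff₀ p₁] at h₁
  linarith

theorem le_rpow (H : IsPowerLike h h' a b) {t : ℝ} (ht : 0 < t) (ht1 : t ≤ 1) :
    h t ≤ h 1 * t ^ a := by
  have h₁ := H.mul_rpow_monotoneOn (mem_Ioi.2 ht) (mem_Ioi.2 one_pos) ht1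
  simp only [Real.one_rpow, mul_one, Real.rpow_neg ht.le] at h₁
  rwa [← div_eq_mul_inv, div_le_iff₀ (Real.rpow_pos_of_pos ht a)] at h₁

theorem tendsto_zero (H : IsPowerLike h h' a b) : Tendsto h (𝓝[>] 0) (𝓝 0) := by
  have h₁ : Tendsto (fun t : ℝ => h 1 * t ^ a) (𝓝[>] 0) (𝓝 0) := by
    have := ((Real.continuousAt_rpow_const 0 a (Or.inr H.a_pos.le)).tendsto.const_mul (h 1))
    rw [Real.zero_rpow H.a_pos.ne', mul_zero] at this
    exact this.mono_left nhdsWithin_le_nhds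
  refine squeeze_zero' ?_ ?_ h₁
  · filter_upwards [self_mem_nhdsWithin] with t ht using (H.pos t ht).le
  · filter_upwards [Ioc_mem_nhdsGT (zero_lt_one (α := ℝ))] with t ht using H.le_rpow ht.1 ht.2

/-- The square root of `t h(t)` has power-like growth. -/
theorem sqrt_mul_id (H : IsPowerLike h h' a b) :
    IsPowerLike (fun t => √(h t * t)) (fun t => (h' t * t + h t) / (2 * √(h t * t)))
      ((a + 1) / 2) ((b + 1) / 2) where
  a_pos := by linarith [H.a_pos]
  hasDerivAt t ht := by
    have h₁ := ((H.hasDerivAt t ht).mul (hasDerivAt_id t)).sqrt (mul_pos (H.pos t ht) ht).ne'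
    simpa using h₁
  pos t ht := Real.sqrt_pos.2 (mul_pos (H.pos t ht) ht)
  lower t ht := by
    have p := Real.sqrt_pos.2 (mul_pos (H.pos t ht) ht)
    have s := Real.mul_self_sqrt (mul_pos (H.pos t ht) ht).le
    -- Taking the root of `t h(t)` turns the logarithmic index `i` of `h` into `(i + 1) / 2`.
    rw [div_mul_eq_mul_div (h' t * t + h t), le_div_iff₀ (by positivity)]
    calc (a + 1) / 2 * √(h t * t) * (2 * √(h t * t)) = (a + 1) * (√(h t * t) * √(h t * t)) := by ring
      _ = (a * h t + h t) * t := by rw [s]; ring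
      _ ≤ (h' t * t + h t) * t := 
        mul_le_mul_of_nonneg_right (by linarith [H.lower t ht]) ht.le
  upper t ht := by
    have p := Real.sqrt_pos.2 (mul_pos (H.pos t ht) ht)
    have s := Real.mul_self_sqrt (mul_pos (H.pos t ht) ht).le
    rw [div_mul_eq_mul_div (h' t * t + h t), div_le_iff₀ (by positivity)]
    calc (h' t * t + h t) * t ≤ (b * h t + h t) * t := 
        mul_le_mul_of_nonneg_right (by linarith [H.upper t ht]) ht.le
      _ = (b + 1) * (√(h t * t) * √(h t * t)) := by rw [s]; ring
      _ = (b + 1) / 2 * √(h t * t) * (2 * √(h t * t)) := by ring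

end IsPowerLike

/-! ### Nonlinear operators with `h`-structure -/

/-- `A` is continuous, vanishes at `0`, and away from `0` has a derivative `A'` that is bounded
from below and above in terms of `h'(‖Q‖)`. -/
structure HasStructure {V : Type*} [NormedAddCommGroup V] [InnerProductSpace ℝ V]
    (h' : ℝ → ℝ) (c₀ c₁ : ℝ) (A : V → V) (A' : V → V →L[ℝ] V) : Prop where
  c₀_pos : 0 < c₀
  c₁_pos : 0 < c₁
  continuous : Continuous A
  map_zero : A 0 = 0
  hasFDerivAt : ∀ Q, Q ≠ 0 → HasFDerivAt A (A' Q) Q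
  lower : ∀ Q, Q ≠ 0 → ∀ P, c₀ * h' ‖Q‖ * ‖P‖ ^ 2 ≤ inner ℝ (A' Q P) P
  upper : ∀ Q, Q ≠ 0 → ∀ P, ‖A' Q P‖ ≤ c₁ * h' ‖Q‖ * ‖P‖

/-- Used along segments that may cross the origin, where `A` need not be differentiable; continuity
bridges the single exceptional parameter. -/
theorem monotone_of_hasDerivAt_nonneg_of_ne {k k' : ℝ → ℝ} (t₀ : ℝ) (hk : Continuous k)
    (hd : ∀ t, t ≠ t₀ → HasDerivAt k (k' t) t) (hn : ∀ t, t ≠ t₀ → 0 ≤ k' t) : Monotone k := by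
  have h₁ : MonotoneOn k (Iic t₀) := by
    refine monotoneOn_of_deriv_nonneg (convex_Iic _) hk.continuousOn ?_ ?_ <;> rw [interior_Iic]
    · exact fun t ht => (hd t (ne_of_lt ht)).differentiableAt.differentiableWithinAt
    · exact fun t ht => (hd t (ne_of_lt ht)).deriv ▸ hn t (ne_of_lt ht)
  have h₂ : MonotoneOn k (Ici t₀) := by
    refine monotoneOn_of_deriv_nonneg (convex_Ici _) hk.continuousOn ?_ ?_ <;> rw [interior_Ici]
    · exact fun t ht => (hd t (ne_of_gt ht)).differentiableAt.differentiableWithinAt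
    · exact fun t ht => (hd t (ne_of_gt ht)).deriv ▸ hn t (ne_of_gt ht)
  exact h₁.Iic_union_Ici h₂

/-- Change of the second argument in `h(‖P‖ + ‖Q‖) / (‖P‖ + ‖Q‖) ‖P - Q‖`. -/
theorem IsPowerLike.quotient_mul_dist_le {V : Type*} [NormedAddCommGroup V]
    {h h' : ℝ → ℝ} {a b : ℝ} (H : IsPowerLike h h' a b) {l : ℝ} (hl : 1 ≤ l)
    {P Q R : V} (hQR : ‖P - Q‖ ≤ l * ‖P - R‖) :
    h (‖P‖ + ‖Q‖) / (‖P‖ + ‖Q‖) * ‖P - Q‖ ≤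
      4 * l * (4 * l) ^ b * (h (‖P‖ + ‖R‖) / (‖P‖ + ‖R‖) * ‖P - R‖) := by
  by_cases hPQ : P = Q
  · subst hPQ
    have : 0 ≤ h (‖P‖ + ‖R‖) / (‖P‖ + ‖R‖) * ‖P - R‖ := by
      by_cases hz : ‖P‖ + ‖R‖ = 0
      · simp [hz]
      · have := H.pos _ (lt_of_le_of_ne (by positivity) (Ne.symm hz))
        positivity
    have h4 : (0 : ℝ) ≤ (4 * l) ^ b := Real.rpow_nonneg (by linarith) _
    simp only [sub_self, norm_zero, mul_zero]
    positivity
  have hl0 : 0 < l := one_pos.trans_le hl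
  set m := ‖P‖
  set s := ‖P - Q‖ with hs
  set t := ‖P - R‖ with ht
  have hm : 0 ≤ m := norm_nonneg P
  have sp : 0 < s := norm_pos_iff.2 (sub_ne_zero.2 hPQ)
  have tp : 0 < t := pos_of_mul_pos_right (sp.trans_le hQR) hl0.le
  have q₁ : s ≤ m + ‖Q‖ := norm_sub_le P Q
  have q₂ : ‖Q‖ ≤ m + s := by
    have := norm_sub_norm_le Q P
    rw [norm_sub_rev] at this
    linarith
  have r₁ : t ≤ m + ‖R‖ := norm_sub_le P R
  have r₂ : ‖R‖ ≤ m + t := by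
    have := norm_sub_norm_le R P
    rw [norm_sub_rev] at this
    linarith
  have Mq : 0 < m + ‖Q‖ := sp.trans_le q₁
  have Mr : 0 < m + ‖R‖ := tp.trans_le r₁
  have hhR := H.pos _ Mr
  -- As `h t / t` need not be monotone, the factors `h (m + ‖Q‖)` and `s / (m + ‖Q‖)` are estimated
  -- separately. Since `‖Q‖ ≤ m + s` and `s ≤ l * t ≤ l * (m + ‖R‖)`, the argument of `h` grows by
  -- at most the factor `4 * l`.
  have i₁ : h (m + ‖Q‖) ≤ (4 * l) ^ b * h (m + ‖R‖) := by
    refine (H.monotoneOn (mem_Ioi.2 Mq) (mem_Ioi.2 (by positivity)) ?_).trans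
      (H.le_mul (l := 4 * l) (by linarith) Mr)
    nlinarith [norm_nonneg Q, norm_nonneg R]
  have i₂ : s / (m + ‖Q‖) ≤ 4 * l * (t / (m + ‖R‖)) := by
    rw [← mul_div_assoc, div_le_div_iff₀ Mq Mr]
    have j₁ : s * (m + ‖R‖) ≤ s * (2 * m + t) :=
      mul_le_mul_of_nonneg_left (by linarith) sp.le
    have j₂ : s * m ≤ l * t * (m + ‖Q‖) := by
      have := norm_nonneg Q
      gcongr
      linarith
    have j₃ : s * t ≤ l * t * (m + ‖Q‖) := by
      nlinarith [mul_le_mul_of_nonneg_left q₁ tp.le, mul_pos tp Mq]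
    nlinarith [mul_pos (mul_pos hl0 tp) Mq]
  have h4 : (0 : ℝ) ≤ (4 * l) ^ b := Real.rpow_nonneg (by linarith) _
  calc h (m + ‖Q‖) / (m + ‖Q‖) * s = h (m + ‖Q‖) * (s / (m + ‖Q‖)) := by ring
    _ ≤ (4 * l) ^ b * h (m + ‖R‖) * (4 * l * (t / (m + ‖R‖))) := by gcongr
    _ = _ := by ring

section Structure

variable {V : Type*} [NormedAddCommGroup V] [InnerProductSpace ℝ V]
  {h h' : ℝ → ℝ} {a b c₀ c₁ : ℝ} {A : V → V} {A' : V → V →L[ℝ] V}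

/-- The inner product is the increment over `[0, 1]` of `k t`, the value of `A` on the segment from
`Q` to `P` tested with `P - Q`. On the last quarter, next to the longer vector `P`, the segment has
norm comparable to `M`, so `k'` is bounded below there; on the rest it suffices that `k` is
monotone. -/
theorem HasStructure.lower_bound_aux (H : IsPowerLike h h' a b) (S : HasStructure h' c₀ c₁ A A')
    {P Q : V} (hPQ : ‖Q‖ ≤ ‖P‖) :
    c₀ * a * (4 ^ b)⁻¹ / 4 * (h (‖P‖ + ‖Q‖) / (‖P‖ + ‖Q‖)) * ‖P - Q‖ ^ 2 ≤
      inner ℝ (A P - A Q) (P - Q) := by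
  by_cases hne : P = Q
  · simp [hne]
  have hsub : P - Q ≠ 0 := sub_ne_zero.2 hne
  have hP : 0 < ‖P‖ := by
    rw [norm_pos_iff]
    rintro rfl
    exact hne (by simpa using hPQ : Q = 0).symm
  set M := ‖P‖ + ‖Q‖ with hM
  have hMpos : 0 < M := by positivity
  let g : ℝ → V := fun t => Q + t • (P - Q)
  let k : ℝ → ℝ := fun t => inner ℝ (A (g t)) (P - Q)
  let k' : ℝ → ℝ := fun t => inner ℝ (A' (g t) (P - Q)) (P - Q)
  have hg : ∀ t, HasDerivAt g (P - Q) t := fun t => by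
    have := ((hasDerivAt_id t).smul_const (P - Q)).const_add Q
    rw [one_smul] at this
    exact this
  have hgc : Continuous g := by fun_prop
  have hkc : Continuous k := (S.continuous.comp hgc).inner continuous_const
  have hk : ∀ t, g t ≠ 0 → HasDerivAt k (k' t) t := fun t ht => by
    have := ((S.hasFDerivAt _ ht).comp_hasDerivAt t (hg t)).inner ℝ (hasDerivAt_const t (P - Q))
    simpa [k, k'] using this
  have hk' : ∀ t, g t ≠ 0 → c₀ * h' ‖g t‖ * ‖P - Q‖ ^ 2 ≤ k' t := fun t ht => S.lower _ ht _
  have hk'0 : ∀ t, g t ≠ 0 → 0 ≤ k' t := fun t ht => le_trans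
    (mul_nonneg (mul_nonneg S.c₀_pos.le (H.deriv_pos (norm_pos_iff.2 ht)).le) (sq_nonneg _))
    (hk' t ht)
  have hmono : Monotone k := by
    by_cases hz : ∃ t₀, g t₀ = 0
    · obtain ⟨t₀, ht₀⟩ := hz
      -- The segment is not degenerate, so it meets the origin at most once.
      have : ∀ t, t ≠ t₀ → g t ≠ 0 := fun t ht h0 => by
        have e : (t - t₀) • (P - Q) = 0 := by
          rw [sub_smul, sub_eq_zero]
          exact add_left_cancel (h0.trans ht₀.symm)
        rcases smul_eq_zero.1 e with e | e
        · exact ht (sub_eq_zero.1 e)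
        · exact hsub e
      exact monotone_of_hasDerivAt_nonneg_of_ne t₀ hkc (fun t ht => hk t (this t ht))
        (fun t ht => hk'0 t (this t ht))
    · push Not at hz
      exact monotone_of_hasDerivAt_nonneg_of_ne 0 hkc (fun t _ => hk t (hz t))
        (fun t _ => hk'0 t (hz t))
  -- For `t ≥ 3 / 4` the norm is at least `(3 / 4 - 1 / 4) * ‖P‖`, and `‖P‖ ≥ M / 2`.
  have hnorm : ∀ t ∈ Icc (3 / 4 : ℝ) 1, M / 4 ≤ ‖g t‖ ∧ ‖g t‖ ≤ M := by
    intro t ht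
    have e : g t = t • P + (1 - t) • Q := by simp only [g]; module
    have n₁ : ‖t • P‖ = t * ‖P‖ := by
      rw [norm_smul, Real.norm_of_nonneg (by linarith [ht.1])]
    have n₂ : ‖(1 - t) • Q‖ = (1 - t) * ‖Q‖ := by
      rw [norm_smul, Real.norm_of_nonneg (by linarith [ht.2])]
    constructor
    · have := norm_sub_le_norm_add (t • P) ((1 - t) • Q)
      rw [← e, n₁, n₂] at this
      nlinarith [ht.1, ht.2, norm_nonneg Q]
    · have := norm_add_le (t • P) ((1 - t) • Q)
      rw [← e, n₁, n₂] at this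
      nlinarith [ht.1, ht.2, norm_nonneg Q]
  have hne0 : ∀ t ∈ Icc (3 / 4 : ℝ) 1, g t ≠ 0 := fun t ht =>
    norm_pos_iff.1 (lt_of_lt_of_le (by positivity) (hnorm t ht).1)
  have h4 : 0 < (4 : ℝ) ^ b := Real.rpow_pos_of_pos (by norm_num) b
  have hlow : ∀ t ∈ Icc (3 / 4 : ℝ) 1,
      c₀ * a * (4 ^ b)⁻¹ * (h M / M) * ‖P - Q‖ ^ 2 ≤ k' t := by
    intro t ht
    refine le_trans (mul_le_mul_of_nonneg_right ?_ (sq_nonneg _)) (hk' t (hne0 t ht))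
    obtain ⟨l, u⟩ := hnorm t ht
    have gp : 0 < ‖g t‖ := norm_pos_iff.2 (hne0 t ht)
    have i₁ : (4 ^ b)⁻¹ * h M ≤ h ‖g t‖ := by
      rw [inv_mul_le_iff₀ h4]
      refine le_trans ?_ (H.le_mul (by norm_num) gp)
      exact H.monotoneOn (mem_Ioi.2 hMpos) (mem_Ioi.2 (by positivity)) (by linarith)
    have i₂ : a * h ‖g t‖ / M ≤ h' ‖g t‖ := by
      rw [div_le_iff₀ hMpos]
      exact (H.lower _ gp).trans (mul_le_mul_of_nonneg_left u (H.deriv_pos gp).le)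
    calc c₀ * a * (4 ^ b)⁻¹ * (h M / M) = c₀ * (a * ((4 ^ b)⁻¹ * h M) / M) := by ring
      _ ≤ c₀ * (a * h ‖g t‖ / M) := by
        have := S.c₀_pos
        have := H.a_pos
        gcongr
      _ ≤ c₀ * h' ‖g t‖ := mul_le_mul_of_nonneg_left i₂ S.c₀_pos.le
  -- The length of this interval is the factor `1 / 4` in the constant.
  have hfin := (convex_Icc (3 / 4 : ℝ) 1).mul_sub_le_image_sub_of_le_deriv hkc.continuousOn
    (fun t ht => (hk t (hne0 t (interior_subset ht))).differentiableAt.differentiableWithinAt)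
    (C := c₀ * a * (4 ^ b)⁻¹ * (h M / M) * ‖P - Q‖ ^ 2)
    (fun t ht => by
      rw [(hk t (hne0 t (interior_subset ht))).deriv]
      exact hlow t (interior_subset ht))
    (3 / 4) (by norm_num) 1 (by norm_num) (by norm_num)
  have e1 : k 1 - k 0 = inner ℝ (A P - A Q) (P - Q) := by
    simp [k, g, inner_sub_left]
  have := hmono (show (0 : ℝ) ≤ 3 / 4 by norm_num)
  rw [← e1]
  linarith

theorem HasStructure.lower_bound (H : IsPowerLike h h' a b) (S : HasStructure h' c₀ c₁ A A')
    (P Q : V) :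
    c₀ * a * (4 ^ b)⁻¹ / 4 * (h (‖P‖ + ‖Q‖) / (‖P‖ + ‖Q‖)) * ‖P - Q‖ ^ 2 ≤
      inner ℝ (A P - A Q) (P - Q) := by
  rcases le_total ‖Q‖ ‖P‖ with hPQ | hPQ
  · exact S.lower_bound_aux H hPQ
  · have := S.lower_bound_aux H hPQ
    rwa [add_comm, norm_sub_rev, ← neg_sub (A P), ← neg_sub P, inner_neg_neg] at this

/-- Along the ray `t • P` the derivative of `A` is dominated by that of `c₁ * h (t * ‖P‖)`. Starting
at `e > 0` avoids the origin; then `e → 0`, using continuity and `A 0 = 0`. -/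
theorem HasStructure.norm_le (H : IsPowerLike h h' a b) (S : HasStructure h' c₀ c₁ A A')
    {P : V} (hP : P ≠ 0) : ‖A P‖ ≤ c₁ * h ‖P‖ := by
  have hPn : 0 < ‖P‖ := norm_pos_iff.2 hP
  have key : ∀ e ∈ Ioc (0 : ℝ) 1, ‖A P - A (e • P)‖ ≤ c₁ * h ‖P‖ := by
    intro e he
    have hg : ∀ t : ℝ, HasDerivAt (fun t : ℝ => t • P) P t := fun t => by
      simpa using (hasDerivAt_id t).smul_const P
    have hne : ∀ t ∈ Icc e 1, t • P ≠ 0 := fun t ht =>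
      smul_ne_zero (he.1.trans_le ht.1).ne' hP
    have hf : ∀ t ∈ Icc e 1,
        HasDerivAt (fun t : ℝ => A (t • P) - A (e • P)) (A' (t • P) P) t := fun t ht =>
      ((S.hasFDerivAt _ (hne t ht)).comp_hasDerivAt t (hg t)).sub_const _
    have hB : ∀ t ∈ Icc e 1, HasDerivAt (fun t : ℝ => c₁ * (h (t * ‖P‖) - h (e * ‖P‖)))
        (c₁ * (h' (t * ‖P‖) * ‖P‖)) t := fun t ht => by
      have h₁ : HasDerivAt (fun t : ℝ => t * ‖P‖) ‖P‖ t := by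
        simpa using (hasDerivAt_id t).mul_const ‖P‖
      exact (((H.hasDerivAt _ (mul_pos (he.1.trans_le ht.1) hPn)).comp t h₁).sub_const _).const_mul _
    have h₁ := image_norm_le_of_norm_deriv_right_le_deriv_boundary'
      (fun t ht => (hf t ht).continuousAt.continuousWithinAt)
      (fun t ht => (hf t (Ico_subset_Icc_self ht)).hasDerivWithinAt) (by simp)
      (fun t ht => (hB t ht).continuousAt.continuousWithinAt)
      (fun t ht => (hB t (Ico_subset_Icc_self ht)).hasDerivWithinAt)
      (fun t ht => by
        have := S.upper _ (hne t (Ico_subset_Icc_self ht)) P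
        rwa [norm_smul, Real.norm_of_nonneg (he.1.trans_le ht.1).le, mul_assoc] at this)
      (right_mem_Icc.2 he.2)
    simp only [one_smul, one_mul] at h₁
    refine h₁.trans (mul_le_mul_of_nonneg_left ?_ S.c₁_pos.le)
    linarith [H.pos _ (mul_pos he.1 hPn)]
  have hlim : Tendsto (fun e : ℝ => ‖A P - A (e • P)‖) (𝓝[>] 0) (𝓝 ‖A P‖) := by
    have hc : Continuous fun e : ℝ => ‖A P - A (e • P)‖ :=
      (continuous_const.sub (S.continuous.comp (by fun_prop))).norm
    have := hc.tendsto 0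
    simp only [zero_smul, S.map_zero, sub_zero] at this
    exact this.mono_left nhdsWithin_le_nhds
  refine le_of_tendsto hlim ?_
  filter_upwards [Ioc_mem_nhdsGT (zero_lt_one (α := ℝ))] with e he using key e he

/-- If `Q` is within `‖P‖ / 2` of `P`, the ball containing both stays away from the origin and the
mean value inequality applies. Otherwise `‖P - Q‖` is comparable to `M` and the growth of `A P` and
`A Q` suffices. The two summands of the constant come from the two cases. -/
theorem HasStructure.upper_bound_aux (H : IsPowerLike h h' a b) (S : HasStructure h' c₀ c₁ A A')
    {P Q : V} (hPQ : ‖Q‖ ≤ ‖P‖) :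
    ‖A P - A Q‖ ≤ (4 * c₁ * b * 2 ^ b + 8 * c₁) * (h (‖P‖ + ‖Q‖) / (‖P‖ + ‖Q‖)) * ‖P - Q‖ := by
  by_cases hne : P = Q
  · simp [hne]
  have hP0 : P ≠ 0 := by
    rintro rfl
    exact hne (by simpa using hPQ : Q = 0).symm
  have hP : 0 < ‖P‖ := norm_pos_iff.2 hP0
  set M := ‖P‖ + ‖Q‖ with hM
  have hQn := norm_nonneg Q
  have hMpos : 0 < M := by positivity
  have hc₁ := S.c₁_pos
  have hb := H.b_pos
  have h2 : 0 < (2 : ℝ) ^ b := Real.rpow_pos_of_pos (by norm_num) b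
  have hPM : h ‖P‖ ≤ h M := H.monotoneOn hP hMpos (by linarith)
  have hhM := H.pos _ hMpos
  have hhP := H.pos _ hP
  -- Here `M ≤ 2 * ‖P‖`, because `P` is the longer vector.
  have hdiv : h ‖P‖ / ‖P‖ ≤ 2 * (h M / M) := by
    rw [← mul_div_assoc, div_le_div_iff₀ hP hMpos]
    nlinarith
  rcases le_total ‖P - Q‖ (‖P‖ / 2) with hs | hs
  · have hball : ∀ x ∈ Metric.closedBall P (‖P‖ / 2), ‖P‖ / 2 ≤ ‖x‖ ∧ ‖x‖ ≤ 2 * ‖P‖ := by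
      intro x hx
      rw [mem_closedBall_iff_norm] at hx
      constructor
      · have := norm_sub_norm_le P x
        rw [norm_sub_rev] at this
        linarith
      · have := norm_sub_norm_le x P
        linarith
    have hx0 : ∀ x ∈ Metric.closedBall P (‖P‖ / 2), 0 < ‖x‖ := fun x hx =>
      lt_of_lt_of_le (by positivity) (hball x hx).1
    have hb' : ∀ x ∈ Metric.closedBall P (‖P‖ / 2),
        ‖A' x‖ ≤ 4 * c₁ * b * 2 ^ b * (h M / M) := by
      intro x hx
      have xp := hx0 x hx
      obtain ⟨l, u⟩ := hball x hx
      have i₁ : h ‖x‖ ≤ 2 ^ b * h ‖P‖ :=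
        (H.monotoneOn xp (mem_Ioi.2 (by positivity)) u).trans (H.le_mul (by norm_num) hP)
      have i₂ : h' ‖x‖ ≤ 2 * (b * 2 ^ b * (h ‖P‖ / ‖P‖)) := by
        have j : h' ‖x‖ * (‖P‖ / 2) ≤ b * (2 ^ b * h ‖P‖) :=
          (mul_le_mul_of_nonneg_left l (H.deriv_pos xp).le).trans
            ((H.upper _ xp).trans (mul_le_mul_of_nonneg_left i₁ hb.le))
        have e : 2 * (b * 2 ^ b * (h ‖P‖ / ‖P‖)) = b * (2 ^ b * h ‖P‖) / (‖P‖ / 2) := by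
          field_simp
        rw [e, le_div_iff₀ (by positivity)]
        exact j
      have i₃ : c₁ * h' ‖x‖ ≤ 4 * c₁ * b * 2 ^ b * (h M / M) := by
        calc c₁ * h' ‖x‖ ≤ c₁ * (2 * (b * 2 ^ b * (h ‖P‖ / ‖P‖))) := by gcongr
          _ ≤ c₁ * (2 * (b * 2 ^ b * (2 * (h M / M)))) := by gcongr
          _ = _ := by ring
      refine ContinuousLinearMap.opNorm_le_bound _ (by positivity) fun y => ?_
      exact (S.upper x (norm_pos_iff.1 xp) y).trans
        (mul_le_mul_of_nonneg_right i₃ (norm_nonneg y))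
    have := (convex_closedBall P (‖P‖ / 2)).norm_image_sub_le_of_norm_hasFDerivWithin_le
      (fun x hx => (S.hasFDerivAt x (norm_pos_iff.1 (hx0 x hx))).hasFDerivWithinAt) hb'
      (show Q ∈ Metric.closedBall P (‖P‖ / 2) by
        rwa [mem_closedBall_iff_norm, norm_sub_rev])
      (Metric.mem_closedBall_self (by positivity))
    refine this.trans ?_
    gcongr
    linarith
  · have hAQ : ‖A Q‖ ≤ c₁ * h ‖P‖ := by
      by_cases hQ : Q = 0
      · rw [hQ, S.map_zero, norm_zero]
        positivity
      · refine (S.norm_le H hQ).trans (mul_le_mul_of_nonneg_left ?_ hc₁.le)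
        exact H.monotoneOn (mem_Ioi.2 (norm_pos_iff.2 hQ)) hP hPQ
    have hAP := S.norm_le H hP0
    have i₁ : h ‖P‖ ≤ 4 * (h M / M) * ‖P - Q‖ := by
      calc h ‖P‖ = h ‖P‖ / ‖P‖ * ‖P‖ := by field_simp
        _ ≤ 2 * (h M / M) * (2 * ‖P - Q‖) := by
          gcongr
          linarith
        _ = _ := by ring
    calc ‖A P - A Q‖ ≤ ‖A P‖ + ‖A Q‖ := norm_sub_le _ _
      _ ≤ 2 * c₁ * h ‖P‖ := by linarith
      _ ≤ 2 * c₁ * (4 * (h M / M) * ‖P - Q‖) := by gcongr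
      _ = 8 * c₁ * (h M / M) * ‖P - Q‖ := by ring
      _ ≤ _ := by
        gcongr
        have : 0 < 4 * c₁ * b * 2 ^ b := by positivity
        linarith

theorem HasStructure.upper_bound (H : IsPowerLike h h' a b) (S : HasStructure h' c₀ c₁ A A')
    (P Q : V) :
    ‖A P - A Q‖ ≤ (4 * c₁ * b * 2 ^ b + 8 * c₁) * (h (‖P‖ + ‖Q‖) / (‖P‖ + ‖Q‖)) * ‖P - Q‖ := by
  rcases le_total ‖Q‖ ‖P‖ with hPQ | hPQ
  · exact S.upper_bound_aux H hPQ
  · have := S.upper_bound_aux H hPQ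
    rwa [norm_sub_rev, add_comm ‖Q‖, norm_sub_rev Q] at this

/-! ### Radial operators -/

/-- The derivative of the radial operator `Q ↦ h(‖Q‖) Q / ‖Q‖`. -/
def radialDeriv (h h' : ℝ → ℝ) (Q : V) : V →L[ℝ] V :=
  (h ‖Q‖ / ‖Q‖) • ContinuousLinearMap.id ℝ V +
    ((h' ‖Q‖ - h ‖Q‖ / ‖Q‖) / ‖Q‖ ^ 2) • (innerSL ℝ Q).smulRight Q

theorem hasFDerivAt_norm_of_ne {Q : V} (hQ : Q ≠ 0) :
    HasFDerivAt (fun x : V => ‖x‖) ((1 / ‖Q‖) • innerSL ℝ Q) Q := by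
  have h₁ := (hasStrictFDerivAt_norm_sq Q).hasFDerivAt.sqrt
    (pow_pos (norm_pos_iff.2 hQ) 2).ne'
  simp only [Real.sqrt_sq (norm_nonneg _)] at h₁
  convert h₁ using 1
  ext y
  simp
  field_simp

theorem hasFDerivAt_radial (H : IsPowerLike h h' a b) {Q : V} (hQ : Q ≠ 0) :
    HasFDerivAt (fun Q : V => (h ‖Q‖ / ‖Q‖) • Q) (radialDeriv h h' Q) Q := by
  have hp := norm_pos_iff.2 hQ
  have h₁ : HasDerivAt (fun t => h t / t) ((h' ‖Q‖ * ‖Q‖ - h ‖Q‖ * 1) / ‖Q‖ ^ 2) ‖Q‖ :=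
    (H.hasDerivAt _ hp).div (hasDerivAt_id _) hp.ne'
  have h₂ := (h₁.comp_hasFDerivAt Q (hasFDerivAt_norm_of_ne hQ)).smul (hasFDerivAt_id Q)
  refine h₂.congr_fderiv ?_
  ext y
  simp only [radialDeriv, add_apply, smul_apply,
    ContinuousLinearMap.id_apply, ContinuousLinearMap.smulRight_apply, innerSL_apply_apply,
    smul_smul, Function.comp_apply, id]
  congr 2
  simp only [smul_eq_mul]
  field_simp

/-- The derivative at `Q` acts as `h' ‖Q‖` in the direction of `Q` and as `h ‖Q‖ / ‖Q‖` on its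
orthogonal complement. The index bounds make the two numbers comparable, with ratios governed by `a`
and `b`. This brings `F` under the bounds for general operators. -/
theorem hasStructure_radial (H : IsPowerLike h h' a b) :
    HasStructure h' (min 1 b⁻¹) (2 * a⁻¹ + 1) (fun Q : V => (h ‖Q‖ / ‖Q‖) • Q)
      (radialDeriv h h') where
  c₀_pos := lt_min one_pos (inv_pos.2 H.b_pos)
  c₁_pos := by have := inv_pos.2 H.a_pos; linarith
  map_zero := by simp
  hasFDerivAt Q hQ := hasFDerivAt_radial H hQ
  continuous := by
    rw [continuous_iff_continuousAt]
    intro Q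
    by_cases hQ : Q = 0
    · subst hQ
      rw [ContinuousAt, smul_zero, tendsto_zero_iff_norm_tendsto_zero]
      rw [Metric.tendsto_nhds]
      intro ε hε
      have h₁ := (Metric.tendsto_nhdsWithin_nhds.1 H.tendsto_zero) ε hε
      obtain ⟨δ, hδ, h₁⟩ := h₁
      filter_upwards [Metric.ball_mem_nhds (0 : V) hδ] with x hx
      by_cases hx0 : x = 0
      · simpa [hx0] using hε
      · have xp := norm_pos_iff.2 hx0
        have h₂ := h₁ (mem_Ioi.2 xp) (by simpa using hx)
        have e : ‖(h ‖x‖ / ‖x‖) • x‖ = h ‖x‖ := by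
          rw [norm_smul, norm_div, norm_norm, div_mul_cancel₀ _ xp.ne',
            Real.norm_of_nonneg (H.pos _ xp).le]
        rwa [e]
    · exact (hasFDerivAt_radial H hQ).continuousAt
  lower Q hQ P := by
    have hp := norm_pos_iff.2 hQ
    have hb := H.b_pos
    have e : inner ℝ (radialDeriv h h' Q P) P =
        h ‖Q‖ / ‖Q‖ * (‖P‖ ^ 2 - (inner ℝ Q P / ‖Q‖) ^ 2) + h' ‖Q‖ * (inner ℝ Q P / ‖Q‖) ^ 2 := by
      simp only [radialDeriv, add_apply, smul_apply,
        ContinuousLinearMap.id_apply, ContinuousLinearMap.smulRight_apply, innerSL_apply_apply,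
        inner_add_left, inner_smul_left, real_inner_self_eq_norm_sq]
      simp only [RCLike.conj_to_real]
      field_simp
      ring
    have hcs : (inner ℝ Q P / ‖Q‖) ^ 2 ≤ ‖P‖ ^ 2 := by
      rw [sq_le_sq, abs_norm, abs_div, abs_norm, div_le_iff₀ hp, mul_comm]
      exact abs_real_inner_le_norm Q P
    have hd := H.deriv_pos hp
    have i₁ : min 1 b⁻¹ * h' ‖Q‖ ≤ h ‖Q‖ / ‖Q‖ := by
      refine (mul_le_mul_of_nonneg_right (min_le_right _ _) hd.le).trans ?_
      rw [inv_mul_le_iff₀ hb, ← mul_div_assoc, le_div_iff₀ hp]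
      exact H.upper _ hp
    have i₂ : min 1 b⁻¹ * h' ‖Q‖ ≤ h' ‖Q‖ :=
      mul_le_of_le_one_left hd.le (min_le_left _ _)
    rw [e]
    calc min 1 b⁻¹ * h' ‖Q‖ * ‖P‖ ^ 2
        = min 1 b⁻¹ * h' ‖Q‖ * (‖P‖ ^ 2 - (inner ℝ Q P / ‖Q‖) ^ 2) +
          min 1 b⁻¹ * h' ‖Q‖ * (inner ℝ Q P / ‖Q‖) ^ 2 := by ring
      _ ≤ _ := add_le_add (mul_le_mul_of_nonneg_right i₁ (sub_nonneg.2 hcs))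
          (mul_le_mul_of_nonneg_right i₂ (sq_nonneg _))
  upper Q hQ P := by
    have hp := norm_pos_iff.2 hQ
    have ha := H.a_pos
    have hd := H.deriv_pos hp
    have hh := H.pos _ hp
    have i₁ : h ‖Q‖ / ‖Q‖ ≤ a⁻¹ * h' ‖Q‖ := by
      rw [div_le_iff₀ hp, mul_assoc, le_inv_mul_iff₀ ha]
      exact H.lower _ hp
    have q : 0 ≤ h ‖Q‖ / ‖Q‖ := by positivity
    have i₂ : |h' ‖Q‖ - h ‖Q‖ / ‖Q‖| ≤ (1 + a⁻¹) * h' ‖Q‖ := by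
      refine (abs_sub _ _).trans ?_
      rw [abs_of_pos hd, abs_of_nonneg q]
      linarith
    have n₁ : ‖(h ‖Q‖ / ‖Q‖) • P‖ ≤ a⁻¹ * h' ‖Q‖ * ‖P‖ := by
      rw [norm_smul, Real.norm_of_nonneg q]
      gcongr
    have n₂ : ‖((h' ‖Q‖ - h ‖Q‖ / ‖Q‖) / ‖Q‖ ^ 2) • ((inner ℝ Q P : ℝ) • Q)‖ ≤
        (1 + a⁻¹) * h' ‖Q‖ * ‖P‖ := by
      rw [norm_smul, norm_smul, norm_div, norm_pow, norm_norm, Real.norm_eq_abs, Real.norm_eq_abs]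
      calc |h' ‖Q‖ - h ‖Q‖ / ‖Q‖| / ‖Q‖ ^ 2 * (|inner ℝ Q P| * ‖Q‖)
          ≤ (1 + a⁻¹) * h' ‖Q‖ / ‖Q‖ ^ 2 * (‖Q‖ * ‖P‖ * ‖Q‖) := by
            gcongr
            exact abs_real_inner_le_norm Q P
        _ = _ := by field_simp
    simp only [radialDeriv, add_apply, smul_apply,
        ContinuousLinearMap.id_apply, ContinuousLinearMap.smulRight_apply, innerSL_apply_apply]
    refine (norm_add_le _ _).trans ((add_le_add n₁ n₂).trans (le_of_eq ?_))
    ring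

/-! ### Pointwise comparison with the natural distance -/

/-- If the operator `A` and the natural distance given by `F` are both comparable to
`h(‖P‖ + ‖Q‖) / (‖P‖ + ‖Q‖)`, then `A` is monotone and satisfies a Young type inequality with
respect to the natural distance. -/
theorem monotone_and_young (H : IsPowerLike h h' a b) {F : V → V} {kA KA kF KF : ℝ}
    (hkA : 0 < kA) (hKA : 0 < KA) (hkF : 0 < kF)
    (lA : ∀ P Q, kA * (h (‖P‖ + ‖Q‖) / (‖P‖ + ‖Q‖)) * ‖P - Q‖ ^ 2 ≤ inner ℝ (A P - A Q) (P - Q))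
    (uA : ∀ P Q, ‖A P - A Q‖ ≤ KA * (h (‖P‖ + ‖Q‖) / (‖P‖ + ‖Q‖)) * ‖P - Q‖)
    (lF : ∀ P Q, kF * (h (‖P‖ + ‖Q‖) / (‖P‖ + ‖Q‖)) * ‖P - Q‖ ^ 2 ≤ ‖F P - F Q‖ ^ 2)
    (uF : ∀ P Q, ‖F P - F Q‖ ^ 2 ≤ KF * (h (‖P‖ + ‖Q‖) / (‖P‖ + ‖Q‖)) * ‖P - Q‖ ^ 2)
    (hKF : 0 < KF) :
    (∀ P Q, ‖F P - F Q‖ ^ 2 ≤ KF / kA * inner ℝ (A P - A Q) (P - Q)) ∧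
    ∀ P Q R, inner ℝ (A P - A Q) (P - R) ≤ 1 / 2 * inner ℝ (A P - A Q) (P - Q) +
      KA * (4 * (1 + 2 * KA / kA) * (4 * (1 + 2 * KA / kA)) ^ b) / kF * ‖F P - F R‖ ^ 2 := by
  constructor
  · intro P Q
    refine (uF P Q).trans ?_
    rw [div_mul_eq_mul_div, le_div_iff₀ hkA]
    nlinarith [mul_le_mul_of_nonneg_left (lA P Q) hKF.le]
  · intro P Q R
    -- The threshold is chosen so that `l * ‖P - R‖ ≤ ‖P - Q‖` forces `KA * ‖P - R‖ ≤ kA / 2 * ‖P -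
    -- Q‖`; the whole term is then absorbed by half of the monotone one.
    set l := 1 + 2 * KA / kA with hl
    have hl1 : 1 ≤ l := by
      have : 0 < 2 * KA / kA := by positivity
      linarith
    have hl0 : 0 < l := by linarith
    have hlp : 0 < (4 * l) ^ b := Real.rpow_pos_of_pos (by linarith) b
    have Snn : ∀ P Q : V, 0 ≤ h (‖P‖ + ‖Q‖) / (‖P‖ + ‖Q‖) := fun P Q => by
      by_cases hz : ‖P‖ + ‖Q‖ = 0
      · simp [hz]
      · have := H.pos _ (lt_of_le_of_ne (by positivity) (Ne.symm hz))
        positivity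
    have i₀ : inner ℝ (A P - A Q) (P - R) ≤
        KA * (h (‖P‖ + ‖Q‖) / (‖P‖ + ‖Q‖)) * ‖P - Q‖ * ‖P - R‖ :=
      (real_inner_le_norm _ _).trans (mul_le_mul_of_nonneg_right (uA P Q) (norm_nonneg _))
    have hY : 0 ≤ KA * (4 * l * (4 * l) ^ b) / kF * ‖F P - F R‖ ^ 2 := by positivity
    have hX := lA P Q
    have hX0 : 0 ≤ kA * (h (‖P‖ + ‖Q‖) / (‖P‖ + ‖Q‖)) * ‖P - Q‖ ^ 2 :=
      mul_nonneg (mul_nonneg hkA.le (Snn P Q)) (sq_nonneg _)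
    rcases le_total (l * ‖P - R‖) ‖P - Q‖ with hc | hc
    · have hc' : KA * ‖P - R‖ ≤ kA / 2 * ‖P - Q‖ := by
        have : 2 * KA / kA * ‖P - R‖ ≤ ‖P - Q‖ := by
          refine le_trans ?_ hc
          rw [hl]
          nlinarith [norm_nonneg (P - R)]
        rw [div_mul_eq_mul_div, div_le_iff₀ hkA] at this
        linarith
      have := mul_le_mul_of_nonneg_left hc' (mul_nonneg (Snn P Q) (norm_nonneg (P - Q)))
      nlinarith
    -- Now `‖P - Q‖` is controlled by `‖P - R‖`, so `Q` can be exchanged for `R` in the quotient.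
    · have i₁ := H.quotient_mul_dist_le hl1 hc
      have i₂ : h (‖P‖ + ‖R‖) / (‖P‖ + ‖R‖) * ‖P - R‖ ^ 2 ≤ ‖F P - F R‖ ^ 2 / kF := by
        rw [le_div_iff₀ hkF]
        linarith [lF P R]
      calc inner ℝ (A P - A Q) (P - R)
          ≤ KA * (h (‖P‖ + ‖Q‖) / (‖P‖ + ‖Q‖) * ‖P - Q‖) * ‖P - R‖ := by linarith
        _ ≤ KA * (4 * l * (4 * l) ^ b * (h (‖P‖ + ‖R‖) / (‖P‖ + ‖R‖) * ‖P - R‖)) * ‖P - R‖ := by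
          gcongr
        _ = KA * (4 * l * (4 * l) ^ b) * (h (‖P‖ + ‖R‖) / (‖P‖ + ‖R‖) * ‖P - R‖ ^ 2) := by ring
        _ ≤ KA * (4 * l * (4 * l) ^ b) * (‖F P - F R‖ ^ 2 / kF) := by gcongr
        _ = KA * (4 * l * (4 * l) ^ b) / kF * ‖F P - F R‖ ^ 2 := by ring
        _ ≤ _ := by linarith

end Structure

/-- The operator `Q ↦ √(h(‖Q‖) ‖Q‖) Q / ‖Q‖` realizes the natural distance. -/
theorem natural_distance_equiv {V : Type*} [NormedAddCommGroup V] [InnerProductSpace ℝ V]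
    {h h' : ℝ → ℝ} {a b : ℝ} (H : IsPowerLike h h' a b) {k K : ℝ}
    (hk : k = min 1 ((b + 1) / 2)⁻¹ * ((a + 1) / 2) * (4 ^ ((b + 1) / 2))⁻¹ / 4)
    (hK : K = 4 * (2 * ((a + 1) / 2)⁻¹ + 1) * ((b + 1) / 2) * 2 ^ ((b + 1) / 2) +
      8 * (2 * ((a + 1) / 2)⁻¹ + 1)) (P Q : V) :
    k ^ 2 * (h (‖P‖ + ‖Q‖) / (‖P‖ + ‖Q‖)) * ‖P - Q‖ ^ 2 ≤
        ‖(√(h ‖P‖ * ‖P‖) / ‖P‖) • P - (√(h ‖Q‖ * ‖Q‖) / ‖Q‖) • Q‖ ^ 2 ∧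
      ‖(√(h ‖P‖ * ‖P‖) / ‖P‖) • P - (√(h ‖Q‖ * ‖Q‖) / ‖Q‖) • Q‖ ^ 2 ≤
        K ^ 2 * (h (‖P‖ + ‖Q‖) / (‖P‖ + ‖Q‖)) * ‖P - Q‖ ^ 2 := by
  have H' := H.sqrt_mul_id
  have S := hasStructure_radial (V := V) H'
  have l := S.lower_bound H' P Q
  have u := S.upper_bound H' P Q
  rw [← hk] at l
  rw [← hK] at u
  by_cases hPQ : P = Q
  · simp [hPQ]
  set D := (√(h ‖P‖ * ‖P‖) / ‖P‖) • P - (√(h ‖Q‖ * ‖Q‖) / ‖Q‖) • Q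
  set M := ‖P‖ + ‖Q‖
  have sp : 0 < ‖P - Q‖ := norm_pos_iff.2 (sub_ne_zero.2 hPQ)
  have Mp : 0 < M := sp.trans_le (norm_sub_le P Q)
  have hM := H.pos M Mp
  -- The quotient belonging to `√(t h(t))` is the square root of the one belonging to `h`; this is
  -- why the constants appear squared.
  have e : (√(h M * M) / M) ^ 2 = h M / M := by
    rw [div_pow, Real.sq_sqrt (by positivity)]
    field_simp
  have k0 : 0 < k := by
    rw [hk]
    have := H'.a_pos
    have := H'.b_pos
    have : 0 < (4 : ℝ) ^ ((b + 1) / 2) := Real.rpow_pos_of_pos (by norm_num) _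
    have := S.c₀_pos
    positivity
  constructor
  -- Cauchy-Schwarz turns the monotonicity bound into a bound for `‖D‖` after division by `‖P - Q‖`.
  · have l' : k * (√(h M * M) / M) * ‖P - Q‖ ≤ ‖D‖ := by
      have := l.trans (real_inner_le_norm _ _)
      rw [pow_two, ← mul_assoc] at this
      exact le_of_mul_le_mul_right this sp
    calc k ^ 2 * (h M / M) * ‖P - Q‖ ^ 2 = (k * (√(h M * M) / M) * ‖P - Q‖) ^ 2 := by
          rw [← e]; ring
      _ ≤ ‖D‖ ^ 2 := by gcongr
  · calc ‖D‖ ^ 2 ≤ (K * (√(h M * M) / M) * ‖P - Q‖) ^ 2 := by gcongr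
      _ = _ := by rw [← e]; ring

/-! ### Weak gradients -/

section WeakGrad

variable {d : ℕ} {Ω U : Set (Vec d)} {v w : Vec d → Vec d} {G H : Vec d → Mat d}

theorem HasWeakGrad.weakGrad (h : HasWeakGrad Ω v G) : HasWeakGrad Ω v (weakGrad Ω v) := by
  have hex : ∃ G, HasWeakGrad Ω v G := ⟨G, h⟩
  rw [NonlinearStokes.weakGrad, dif_pos hex]
  exact hex.choose_spec

/-- The fundamental lemma of the calculus of variations, entry by entry. -/
theorem ae_eq_of_integral_mul_test_eq (hU : IsOpen U) (hG : LocallyIntegrableOn G U)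
    (hH : LocallyIntegrableOn H U)
    (h : ∀ ψ : Vec d → ℝ, IsTest U ψ → ∀ i j : Fin d,
      ∫ x in U, G x (i, j) * ψ x = ∫ x in U, H x (i, j) * ψ x) :
    ∀ᵐ x, x ∈ U → G x = H x := by
  have key : ∀ p : Fin d × Fin d, ∀ᵐ x, x ∈ U → G x p - H x p = 0 := by
    rintro ⟨i, j⟩
    have hl : LocallyIntegrableOn (fun x => G x (i, j) - H x (i, j)) U := by
      have h₁ := hG.sub hH
      intro x hx
      obtain ⟨s, hs, hi⟩ := h₁ x hx
      exact ⟨s, hs, (EuclideanSpace.proj (𝕜 := ℝ) (i, j) : Mat d →L[ℝ] ℝ).integrable_comp hi⟩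
    refine hU.ae_eq_zero_of_integral_contDiff_smul_eq_zero hl fun ψ hψ hc hs => ?_
    have ht : IsTest U ψ := ⟨hψ, hc, hs⟩
    have e : ∀ x, ψ x • (G x (i, j) - H x (i, j)) = G x (i, j) * ψ x - H x (i, j) * ψ x :=
      fun x => by rw [smul_eq_mul]; ring
    simp only [e]
    rw [← setIntegral_eq_integral_of_forall_compl_eq_zero (s := U), integral_sub, h ψ ht, sub_self]
    · exact integrableOn_mul_test hG hψ.continuous hc hs (i, j)
    · exact integrableOn_mul_test hH hψ.continuous hc hs (i, j)
    · intro x hx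
      have : ψ x = 0 := image_eq_zero_of_notMem_tsupport fun hx' => hx (hs hx')
      simp [this]
  filter_upwards [ae_all_iff.2 key] with x hx hxU
  ext p
  exact sub_eq_zero.1 (hx p hxU)

theorem HasWeakGrad.ae_eq (hΩ : IsOpen Ω) (hG : HasWeakGrad Ω v G) (hH : HasWeakGrad Ω v H) :
    G =ᵐ[volume.restrict Ω] H := by
  refine (ae_restrict_iff' hΩ.measurableSet).2
    (ae_eq_of_integral_mul_test_eq hΩ hG.2.1 hH.2.1 fun ψ hψ i j => ?_)
  rw [← neg_inj, ← hG.2.2 ψ hψ i j, hH.2.2 ψ hψ i j]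

/-- Where `v` coincides with a smooth field, the weak gradient is the classical one. -/
theorem HasWeakGrad.ae_eq_grad (hU : IsOpen U) (hUΩ : U ⊆ Ω)
    (hG : HasWeakGrad Ω v G) (hw : ContDiff ℝ ∞ w) (hvw : ∀ x ∈ U, v x = w x) :
    ∀ᵐ x, x ∈ U → G x = grad w x := by
  refine ae_eq_of_integral_mul_test_eq hU (hG.2.1.mono_set hUΩ)
    ((continuous_grad hw).locallyIntegrable.locallyIntegrableOn U) fun ψ hψ i j => ?_
  -- A test function in `U` is one in `Ω`, and every integral against it extends by zero to the
  -- whole space, where `w` is smooth and can be integrated by parts.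
  have hψΩ : IsTest Ω ψ := ⟨hψ.1, hψ.2.1, hψ.2.2.trans hUΩ⟩
  have hz : ∀ x, x ∉ U → ψ x = 0 := fun x hx =>
    image_eq_zero_of_notMem_tsupport fun hx' => hx (hψ.2.2 hx')
  have hz' : ∀ x, x ∉ U → fderiv ℝ ψ x (unitVec j) = 0 := fun x hx =>
    image_eq_zero_of_notMem_tsupport (f := fun x => fderiv ℝ ψ x (unitVec j)) fun hx' =>
      hx (hψ.2.2 (tsupport_fderiv_apply_subset ℝ _ hx'))
  have e₁ : ∫ x in U, G x (i, j) * ψ x = ∫ x in Ω, G x (i, j) * ψ x := by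
    rw [setIntegral_eq_integral_of_forall_compl_eq_zero fun x hx => by simp [hz x hx],
      setIntegral_eq_integral_of_forall_compl_eq_zero fun x hx => by
        simp [hz x fun h => hx (hUΩ h)]]
  have e₂ : ∫ x in Ω, v x i * fderiv ℝ ψ x (unitVec j) =
      ∫ x, w x i * fderiv ℝ ψ x (unitVec j) := by
    rw [setIntegral_eq_integral_of_forall_compl_eq_zero fun x hx => by
        simp [hz' x fun h => hx (hUΩ h)]]
    refine integral_congr_ae (Eventually.of_forall fun x => ?_)
    by_cases hx : x ∈ U
    · simp [hvw x hx]
    · simp [hz' x hx]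
  have hwi : ContDiff ℝ ∞ fun x => w x i :=
    (EuclideanSpace.proj (𝕜 := ℝ) i : Vec d →L[ℝ] ℝ).contDiff.comp hw
  have hfd : ∀ x, fderiv ℝ (fun x => w x i) x (unitVec j) = grad w x (i, j) := fun x => by
    have := ((EuclideanSpace.proj (𝕜 := ℝ) i : Vec d →L[ℝ] ℝ).hasFDerivAt.comp x
      ((hw.differentiable (by simp)) x).hasFDerivAt).fderiv
    have e : fderiv ℝ (fun x => w x i) x =
      (EuclideanSpace.proj (𝕜 := ℝ) i : Vec d →L[ℝ] ℝ).comp (fderiv ℝ w x) := this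
    rw [e]
    rfl
  have c₁ : Continuous fun x => fderiv ℝ (fun x => w x i) x (unitVec j) :=
    (hwi.continuous_fderiv (by simp)).clm_apply continuous_const
  have c₂ : Continuous fun x => fderiv ℝ ψ x (unitVec j) :=
    (hψ.1.continuous_fderiv (by simp)).clm_apply continuous_const
  have s₂ : HasCompactSupport fun x => fderiv ℝ ψ x (unitVec j) := hψ.2.1.fderiv_apply ℝ _
  have e₃ := integral_mul_fderiv_eq_neg_fderiv_mul_of_integrable (μ := volume)
    (f := fun x => w x i) (g := ψ) (v := unitVec j)
    ((c₁.mul hψ.1.continuous).integrable_of_hasCompactSupport hψ.2.1.mul_left)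
    ((hwi.continuous.mul c₂).integrable_of_hasCompactSupport s₂.mul_left)
    ((hwi.continuous.mul hψ.1.continuous).integrable_of_hasCompactSupport hψ.2.1.mul_left)
    (fun x _ => hwi.differentiable (by simp) x) (fun x _ => hψ.1.differentiable (by simp) x)
  rw [e₁, ← neg_inj, ← hG.2.2 ψ hψΩ i j, e₂, e₃,
    setIntegral_eq_integral_of_forall_compl_eq_zero fun x hx => by simp [hz x hx]]
  simp only [hfd]

theorem integral_grad_test (hψ : IsTest Ω v) (p : Fin d × Fin d) :
    ∫ x in Ω, grad v x p = 0 := by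
  have hc : HasCompactSupport fun x => v x p.1 :=
    hψ.2.1.comp_left (g := fun y : Vec d => y p.1) rfl
  have hwi : ContDiff ℝ ∞ fun x => v x p.1 :=
    (EuclideanSpace.proj (𝕜 := ℝ) p.1 : Vec d →L[ℝ] ℝ).contDiff.comp hψ.1
  have hfd : ∀ x, fderiv ℝ (fun x => v x p.1) x (unitVec p.2) = grad v x p := fun x => by
    have := ((EuclideanSpace.proj (𝕜 := ℝ) p.1 : Vec d →L[ℝ] ℝ).hasFDerivAt.comp x
      ((hψ.1.differentiable (by simp)) x).hasFDerivAt).fderiv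
    have e : fderiv ℝ (fun x => v x p.1) x =
      (EuclideanSpace.proj (𝕜 := ℝ) p.1 : Vec d →L[ℝ] ℝ).comp (fderiv ℝ v x) := this
    rw [e]
    rfl
  have c₁ : Continuous fun x => fderiv ℝ (fun x => v x p.1) x (unitVec p.2) :=
    (hwi.continuous_fderiv (by simp)).clm_apply continuous_const
  have s₁ : HasCompactSupport fun x => fderiv ℝ (fun x => v x p.1) x (unitVec p.2) :=
    hc.fderiv_apply ℝ _
  -- Integration by parts against the constant `1`.
  have e₃ := integral_mul_fderiv_eq_neg_fderiv_mul_of_integrable (μ := volume)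
    (f := fun _ : Vec d => (1 : ℝ)) (g := fun x => v x p.1) (v := unitVec p.2)
    (by simp)
    ((continuous_const.mul c₁).integrable_of_hasCompactSupport s₁.mul_left)
    ((continuous_const.mul hwi.continuous).integrable_of_hasCompactSupport hc.mul_left)
    (fun x _ => differentiableAt_const _) (fun x _ => hwi.differentiable (by simp) x)
  simp only [one_mul, hfd] at e₃
  rw [setIntegral_eq_integral_of_forall_compl_eq_zero, e₃]
  · simp
  · intro x hx
    have h0 : fderiv ℝ v x = 0 := fderiv_of_notMem_tsupport ℝ fun hx' => hx (hψ.2.2 hx')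
    simp [grad, h0]

/-- Gradients of test fields have integral zero, and this survives the `L^1` limit. -/
theorem HasZeroTrace.integral_eq_zero (h : HasZeroTrace Ω v G)
    (hG : IntegrableOn G Ω) (p : Fin d × Fin d) : ∫ x in Ω, G x p = 0 := by
  have hGp : IntegrableOn (fun x => G x p) Ω :=
    (EuclideanSpace.proj (𝕜 := ℝ) p : Mat d →L[ℝ] ℝ).integrable_comp hG
  rw [← norm_le_zero_iff]
  refine le_of_forall_pos_le_add fun ε hε => ?_
  obtain ⟨ψ, hψ, hlt⟩ := h (ENNReal.ofReal ε) (ENNReal.ofReal_pos.2 hε)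
  have hgi : Integrable (grad ψ) := by
    refine (continuous_grad hψ.1).integrable_of_hasCompactSupport
      (hψ.2.1.fderiv ℝ |>.mono' fun x hx => subset_tsupport _ fun h0 => hx ?_)
    ext p
    simp [grad, h0]
  have hgp : IntegrableOn (fun x => grad ψ x p) Ω :=
    (EuclideanSpace.proj (𝕜 := ℝ) p : Mat d →L[ℝ] ℝ).integrable_comp hgi.integrableOn
  have e : ∫ x in Ω, G x p = ∫ x in Ω, (G x p - grad ψ x p) := by
    rw [integral_sub hGp hgp, integral_grad_test hψ p, sub_zero]
  rw [e, zero_add]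
  refine (norm_integral_le_lintegral_norm _).trans ?_
  refine ENNReal.toReal_le_of_le_ofReal hε.le ?_
  refine le_trans ?_ (le_add_self.trans hlt.le)
  rw [eLpNorm_one_eq_lintegral_enorm]
  refine lintegral_mono fun x => ?_
  rw [ofReal_norm]
  exact enorm_le_iff_norm_le.2 (PiLp.norm_apply_le (G x - grad ψ x) p)

theorem integrableOn_of_memLp_top {X : Type*} [NormedAddCommGroup X] {g : Vec d → X}
    (hb : Bornology.IsBounded Ω) (hg : MemLp g ⊤ (volume.restrict Ω)) : IntegrableOn g Ω := by
  have : IsFiniteMeasure (volume.restrict Ω) :=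
    isFiniteMeasure_restrict.2 hb.measure_lt_top.ne
  exact memLp_one_iff_integrable.1 (hg.mono_exponent le_top)

theorem integral_weakDiv_eq_zero (hΩ : IsOpen Ω) (hb : Bornology.IsBounded Ω)
    (hv : v ∈ W01Infty Ω) : ∫ x in Ω, weakDiv Ω v x = 0 := by
  obtain ⟨G, h₁, -, h₃, h₄⟩ := hv
  have hG := integrableOn_of_memLp_top hb h₃
  have e : weakDiv Ω v =ᵐ[volume.restrict Ω] fun x => ∑ i, G x (i, i) := by
    filter_upwards [h₁.weakGrad.ae_eq hΩ h₁] with x hx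
    simp [weakDiv, tr, hx]
  rw [integral_congr_ae e, integral_finsetSum]
  · exact Finset.sum_eq_zero fun i _ => h₄.integral_eq_zero hG (i, i)
  · exact fun i _ => (EuclideanSpace.proj (𝕜 := ℝ) (i, i) : Mat d →L[ℝ] ℝ).integrable_comp hG

end WeakGrad

/-! ### The smoothing operator preserves the divergence -/

theorem contDiff_eval {d : ℕ} (P : MvPolynomial (Fin d) ℝ) :
    ContDiff ℝ ∞ fun x : Vec d => MvPolynomial.eval (fun j => x j) P := by
  induction P using MvPolynomial.induction_on with
  | C a => simpa using contDiff_const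
  | add p q hp hq => simpa using hp.add hq
  | mul_X p i hp =>
    simpa using hp.mul (EuclideanSpace.proj (𝕜 := ℝ) i : Vec d →L[ℝ] ℝ).contDiff

namespace Mesh

variable {d : ℕ} (T : Mesh d) {Ω : Set (Vec d)}

theorem contDiff_affine {X : Type*} [NormedAddCommGroup X] [NormedSpace ℝ X]
    (g : Vec d →ᵃ[ℝ] X) : ContDiff ℝ ∞ g := by
  have e : (g : Vec d → X) = fun x => g.linear.toContinuousLinearMap x + g 0 := by
    funext x
    rw [AffineMap.decomp g]
    simp
  rw [e]
  exact (ContinuousLinearMap.contDiff _).add contDiff_const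

/-- In a fixed element both terms are given by polynomial formulas that make sense on the whole
space. -/
theorem contDiff_averaging_add (α : Vec d → T.elements → ℝ) (v : T.BrokenP1) (K : T.elements) :
    ContDiff ℝ ∞ fun x => T.averaging Ω α v K x + T.faceCorrection Ω α v K x := by
  refine ContDiff.add ?_ ?_
  · exact ContDiff.sum fun z _ => (contDiff_affine _).fun_smul contDiff_const
  · refine ContDiff.sum fun F _ => ContDiff.fun_smul ?_ contDiff_const
    exact contDiff_prod fun z _ => contDiff_affine _

/-- Convex sets have null boundary, so almost every point of `Ω` is interior to some subsimplex. -/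
theorem convex_subElement (K : T.elements) (z : Vec d) : Convex ℝ (T.subElement K z) := by
  have e : T.subElement K z =
      hull K.1 ∩ ⋂ y ∈ K.1, (T.bary K y - T.bary K z) ⁻¹' Ici (0 : ℝ) := by
    ext x
    simp [subElement]
  rw [e]
  exact (convex_convexHull ℝ _).inter
    (convex_iInter₂ fun y _ => (convex_Ici 0).affine_preimage _)

theorem hull_subset_iUnion (K : T.elements) : hull K.1 ⊆ ⋃ z ∈ K.1, T.subElement K z := by
  intro x hx
  have hne : K.1.Nonempty := by
    rw [Finset.nonempty_iff_ne_empty]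
    intro h0
    simp [hull, h0] at hx
  obtain ⟨z, hz, hmin⟩ := K.1.exists_min_image (fun z => T.bary K z x) hne
  exact mem_iUnion₂.2 ⟨z, hz, hx, hmin⟩

theorem mem_faces (K : T.elements) : K.1 ∈ T.complex.faces ∧ K.1.card = d + 1 := by
  simpa [elements] using K.2

theorem interior_hull_nonempty (K : T.elements) : (interior (hull K.1)).Nonempty := by
  rw [hull, interior_convexHull_nonempty_iff_affineSpan_eq_top]
  have h := (T.elementBasis K).tot
  have e : range (T.elementBasis K) = (K.1 : Set (Vec d)) := Subtype.range_coe
  rwa [e] at h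

/-- Distinct elements meet inside the hull of their common vertices, at most `d` points, which has
empty interior. -/
theorem disjoint_interior_hull {K L : T.elements} (hKL : K ≠ L) :
    Disjoint (interior (hull K.1)) (interior (hull L.1)) := by
  classical
  rw [Set.disjoint_iff_inter_eq_empty, ← interior_inter, ← Set.not_nonempty_iff_eq_empty]
  intro hne
  have hsub : hull K.1 ∩ hull L.1 ⊆ convexHull ℝ ((K.1 ∩ L.1 : Finset (Vec d)) : Set (Vec d)) := by
    rw [Finset.coe_inter]
    exact T.complex.inter_subset_convexHull (T.mem_faces K).1 (T.mem_faces L).1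
  have h₁ := hne.mono (interior_mono hsub)
  rw [interior_convexHull_nonempty_iff_affineSpan_eq_top] at h₁
  have hcard : (K.1 ∩ L.1).card < d + 1 := by
    rw [← (T.mem_faces K).2]
    refine Finset.card_lt_card (Finset.ssubset_iff_subset_ne.2 ⟨Finset.inter_subset_left, ?_⟩)
    intro e
    have hKL' : K.1 ⊆ L.1 := Finset.inter_eq_left.1 e
    exact hKL (Subtype.ext (Finset.eq_of_subset_of_card_le hKL'
      (by rw [(T.mem_faces K).2, (T.mem_faces L).2])))
  have hind : AffineIndependent ℝ ((↑) : (K.1 ∩ L.1 : Finset (Vec d)) → Vec d) :=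
    (T.complex.indep (T.mem_faces K).1).mono (by
      simp)
  have h₂ := hind.affineSpan_eq_top_iff_card_eq_finrank_add_one.1 (by
    rwa [show range ((↑) : (K.1 ∩ L.1 : Finset (Vec d)) → Vec d) =
      ((K.1 ∩ L.1 : Finset (Vec d)) : Set (Vec d)) from Subtype.range_coe])
  simp at h₂
  omega

theorem pw_eq (g : T.elements → ℝ) {K : T.elements} {x : Vec d} (hx : x ∈ interior (hull K.1)) :
    T.pw g x = g K := by
  classical
  rw [pw, Finset.sum_eq_single K]
  · exact indicator_of_mem hx _
  · intro L _ hL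
    exact indicator_of_notMem
      (fun hx' => (Set.disjoint_left.1 (T.disjoint_interior_hull hL) hx') hx) _
  · simp

theorem pw_zero : T.pw (fun _ => 0) = fun _ => 0 := by
  funext x
  simp [pw]

variable {T}

theorem IsMeshOf.ae_mem_interior_subElement (hT : T.IsMeshOf Ω) :
    ∀ᵐ x, x ∈ Ω → ∃ K : T.elements, ∃ z ∈ K.1, x ∈ interior (T.subElement K z) := by
  have hnull : ∀ᵐ x : Vec d, ∀ K : T.elements, ∀ z : K.1, x ∉ frontier (T.subElement K z) := by
    refine ae_all_iff.2 fun K => ae_all_iff.2 fun z => ?_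
    exact measure_eq_zero_iff_ae_notMem.1 ((T.convex_subElement K z).addHaar_frontier volume)
  filter_upwards [hnull] with x hx hxΩ
  have h₁ : x ∈ ⋃ K ∈ T.elements, hull K := hT.closure_eq ▸ subset_closure hxΩ
  obtain ⟨K, hK, hxK⟩ := mem_iUnion₂.1 h₁
  obtain ⟨z, hz, hxz⟩ := mem_iUnion₂.1 (T.hull_subset_iUnion ⟨K, hK⟩ hxK)
  refine ⟨⟨K, hK⟩, z, hz, ?_⟩
  by_contra hni
  exact hx ⟨K, hK⟩ ⟨z, hz⟩ ⟨subset_closure hxz, hni⟩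

/-- Inside a subsimplex `E v` is a smooth field, so its weak gradient is the classical one and the
local equation for the element bubble makes the divergences of the nodal average and of the face
correction cancel. Interfaces are null sets and carry no singular part, because `E v` has a weak
gradient in all of `Ω`. -/
theorem IsSmoothingOperator.weakDiv_ae_eq (hT : T.IsMeshOf Ω) {E : T.CR Ω →ₗ[ℝ] W01Infty Ω}
    (hE : T.IsSmoothingOperator Ω E) (v : T.CR Ω) :
    weakDiv Ω (E v).1 =ᵐ[volume.restrict Ω] T.pw (T.divh v.1) := by
  obtain ⟨α, -, hE⟩ := hE
  obtain ⟨G, hG, -⟩ := (E v).2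
  have hW := hG.weakGrad
  have key : ∀ K : T.elements, ∀ z : K.1, ∀ᵐ x, x ∈ Ω ∩ interior (T.subElement K z) →
      weakDiv Ω (E v).1 x = T.divh v.1 K := by
    intro K z
    obtain ⟨w, hw, hEv⟩ := hE v K
    choose P hP using hw.isElementBubble.2.2 z z.2
    -- The polynomial extends the bubble beyond the subsimplex to a globally smooth field.
    let q : Vec d → Vec d := fun x => WithLp.toLp 2 fun i => MvPolynomial.eval (fun j => x j) (P i)
    have hq : ContDiff ℝ ∞ q := by
      rw [contDiff_euclidean]
      exact fun i => contDiff_eval (P i)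
    have hwq : ∀ x ∈ T.subElement K z, w x = q x := fun x hx => by
      ext i
      exact hP i x hx
    have ha := T.contDiff_averaging_add (Ω := Ω) α v.1 K
    have hopen : IsOpen (Ω ∩ interior (T.subElement K z)) := hT.isOpen.inter isOpen_interior
    have hae := hW.ae_eq_grad hopen inter_subset_left (ha.add hq) (fun x hx => by
      have hx' := interior_subset hx.2
      rw [hEv x hx'.1, hwq x hx'])
    filter_upwards [hae] with x hx hxU
    have hloc : grad w x = grad q x := by
      have : w =ᶠ[𝓝 x] q := by
        filter_upwards [isOpen_interior.mem_nhds hxU.2] with y hy using hwq y (interior_subset hy)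
      simp only [grad, this.fderiv_eq]
    have hadd := congrFun (grad_add (ha.differentiable (by simp)) (hq.differentiable (by simp))) x
    have hd := hw.div_eq z z.2 x hxU.2
    rw [hloc] at hd
    have htr : ∀ M N : Mat d, tr (M + N) = tr M + tr N := fun M N => by
      simp [tr, Finset.sum_add_distrib]
    have hx' : NonlinearStokes.weakGrad Ω (E v).1 x = grad ((fun x =>
      T.averaging Ω α v.1 K x + T.faceCorrection Ω α v.1 K x) + q) x := hx hxU
    rw [weakDiv, hx', hadd, Pi.add_apply, htr, hd]
    ring
  refine (ae_restrict_iff' hT.isOpen.measurableSet).2 ?_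
  filter_upwards [hT.ae_mem_interior_subElement,
    ae_all_iff.2 fun K => ae_all_iff.2 (key K)] with x hx hk hxΩ
  obtain ⟨K, z, hz, hxi⟩ := hx hxΩ
  rw [hk K ⟨z, hz⟩ ⟨hxΩ, hxi⟩, T.pw_eq _ (interior_mono (fun y hy => hy.1) hxi)]

/-- A Crouzeix-Raviart function that satisfies the discrete mass equation is element-wise
divergence-free. -/
theorem mem_Zh_of_mass (hT : T.IsMeshOf Ω) {E : T.CR Ω →ₗ[ℝ] W01Infty Ω}
    (hE : T.IsSmoothingOperator Ω E) (v : T.CR Ω)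
    (hm : ∀ q ∈ T.S00hat Ω, ∫ x in Ω, T.pw q x * T.pw (T.divh v.1) x = 0) : v ∈ T.Zh Ω := by
  have hae := hE.weakDiv_ae_eq hT v
  -- The divergence may be tested with itself: its mean is that of `div E v`, which vanishes by the
  -- zero boundary values.
  have h0 : T.divh v.1 ∈ T.S00hat Ω := by
    change ∫ x in Ω, T.pw (T.divh v.1) x = 0
    rw [← integral_congr_ae hae]
    exact integral_weakDiv_eq_zero hT.isOpen hT.isBounded (E v).2
  have h₁ := hm _ h0
  have : IsFiniteMeasure (volume.restrict Ω) :=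
    isFiniteMeasure_restrict.2 hT.isBounded.measure_lt_top.ne
  have hbd : ∀ x, ‖T.pw (T.divh v.1) x‖ ≤ ∑ K, |T.divh v.1 K| := fun x => by
    refine (norm_sum_le _ _).trans (Finset.sum_le_sum fun K _ => ?_)
    exact norm_indicator_le_norm_self (fun _ => T.divh v.1 K) x
  have hmeas : Measurable (T.pw (T.divh v.1)) :=
    Finset.measurable_fun_sum _ fun K _ => measurable_const.indicator isOpen_interior.measurableSet
  have hint : Integrable (fun x => T.pw (T.divh v.1) x * T.pw (T.divh v.1) x)
      (volume.restrict Ω) := by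
    refine Integrable.of_bound (hmeas.mul hmeas).aestronglyMeasurable
      ((∑ K, |T.divh v.1 K|) * ∑ K, |T.divh v.1 K|) (Eventually.of_forall fun x => ?_)
    rw [norm_mul]
    exact mul_le_mul (hbd x) (hbd x) (norm_nonneg _) ((norm_nonneg _).trans (hbd x))
  rw [integral_eq_zero_iff_of_nonneg (fun x => mul_self_nonneg _) hint] at h₁
  have h₂ := (ae_restrict_iff' hT.isOpen.measurableSet).1 h₁
  intro K
  have hopen : IsOpen (interior (hull K.1) ∩ Ω) := isOpen_interior.inter hT.isOpen
  have hne : (interior (hull K.1) ∩ Ω).Nonempty := by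
    obtain ⟨x, hx⟩ := T.interior_hull_nonempty K
    have hxc : x ∈ closure Ω := by
      rw [hT.closure_eq]
      exact mem_iUnion₂.2 ⟨K.1, K.2, interior_subset hx⟩
    exact mem_closure_iff.1 hxc _ isOpen_interior hx
  -- This open set has positive measure, so almost everywhere vanishing yields a point of the
  -- element where the constant value is zero.
  obtain ⟨x, hx, hxU⟩ := (h₂.and_frequently
    (frequently_ae_mem_iff.2 (hopen.measure_pos volume hne).ne')).exists
  have h₃ := hx hxU.2
  simp only [Pi.zero_apply, mul_self_eq_zero] at h₃
  rwa [T.pw_eq _ hxU.1] at h₃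

end Mesh

/-! ### Operators with `φ`-structure -/

theorem IsUniformlyConvexNFunction.isPowerLike {φ : ℝ → ℝ} {rm rp : ℝ}
    (hφ : IsUniformlyConvexNFunction φ rm rp) :
    IsPowerLike (deriv φ) (deriv (deriv φ)) (rm - 1) (rp - 1) := by
  have hl : ∀ t, 0 < t → rm ≤ deriv (deriv φ) t * t / deriv φ t + 1 := fun t ht =>
    hφ.isGLB.1 (mem_image_of_mem _ ht)
  have hu : ∀ t, 0 < t → deriv (deriv φ) t * t / deriv φ t + 1 ≤ rp := fun t ht =>
    hφ.isLUB.1 (mem_image_of_mem _ ht)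
  have hpos : ∀ t, 0 < t → 0 < deriv φ t := fun t ht => by
    refine lt_of_le_of_ne ?_ fun h0 => ?_
    · rw [← derivWithin_of_mem_nhds (Ici_mem_nhds ht)]
      exact hφ.isNFunction.strictMonoOn.monotoneOn.derivWithin_nonneg
    -- If `φ'` vanished at `t`, division by zero would give the quotient the value `0` and the index
    -- the value `1`, below `rm`.
    · have := hl t ht
      rw [← h0, div_zero, zero_add] at this
      linarith [hφ.one_lt]
  have hd : ContDiffOn ℝ 1 (deriv φ) (Ioi 0) :=
    hφ.contDiffOn.deriv_of_isOpen isOpen_Ioi (by norm_num)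
  refine ⟨by linarith [hφ.one_lt], fun t ht => ?_, hpos, fun t ht => ?_, fun t ht => ?_⟩
  · exact ((hd.differentiableOn (by simp)).differentiableAt (Ioi_mem_nhds ht)).hasDerivAt
  · rw [← le_div_iff₀ (hpos t ht)]
    linarith [hl t ht]
  · rw [← div_le_iff₀ (hpos t ht)]
    linarith [hu t ht]

theorem eq_sum_unitMat {d : ℕ} (P : Mat d) :
    P = ∑ k, ∑ l, P (k, l) • unitMat k l := by
  ext p
  rw [← Fintype.sum_prod_type' (f := fun k l => P (k, l) • unitMat k l)]
  simp [unitMat, Finset.sum_apply, Pi.single_apply]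

theorem norm_le_sum_entries {d : ℕ} (P : Mat d) : ‖P‖ ≤ ∑ k, ∑ l, |P (k, l)| := by
  conv_lhs => rw [eq_sum_unitMat P]
  refine (norm_sum_le _ _).trans (Finset.sum_le_sum fun k _ => (norm_sum_le _ _).trans
    (Finset.sum_le_sum fun l _ => ?_))
  simp [norm_smul, unitMat]

theorem HasPhiStructure.hasStructure {d : ℕ} (hd : d ≤ 3) {φ : ℝ → ℝ} {C₀ C₁ a b : ℝ}
    {A : Mat d → Mat d} (hA : HasPhiStructure φ C₀ C₁ A)
    (H : IsPowerLike (deriv φ) (deriv (deriv φ)) a b) :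
    HasStructure (deriv (deriv φ)) C₀ (81 * C₁) A (fderiv ℝ A) where
  c₀_pos := hA.C₀_pos
  c₁_pos := by linarith [hA.C₁_pos]
  continuous := hA.continuous
  map_zero := hA.map_zero
  hasFDerivAt Q hQ := ((hA.contDiffOn.differentiableOn (by simp)).differentiableAt
    (isOpen_compl_singleton.mem_nhds hQ)).hasFDerivAt
  lower Q hQ P := by
    refine (hA.coercive P Q hQ).trans (le_of_eq ?_)
    have e : ∀ i j, fderiv ℝ A Q P (i, j) =
        ∑ k, ∑ l, P (k, l) * fderiv ℝ A Q (unitMat k l) (i, j) := fun i j => by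
      conv_lhs => rw [eq_sum_unitMat P]
      simp [map_sum]
    rw [PiLp.inner_apply, Fintype.sum_prod_type]
    refine Finset.sum_congr rfl fun i _ => Finset.sum_congr rfl fun j _ => ?_
    rw [e i j]
    simp only [RCLike.inner_apply, conj_trivial, Finset.mul_sum]
    refine Finset.sum_congr rfl fun k _ => Finset.sum_congr rfl fun l _ => ?_
    ring
  upper Q hQ P := by
    have hdd := (H.deriv_pos (norm_pos_iff.2 hQ)).le
    have hC := hA.C₁_pos.le
    have hd' : (d : ℝ) ≤ 3 := by exact_mod_cast hd
    set c := C₁ * deriv (deriv φ) ‖Q‖ with hc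
    have hc0 : 0 ≤ c := mul_nonneg hC hdd
    -- The entrywise bound is summed over the at most nine entries of each of two matrices, hence
    -- the factor `81`.
    have h9 : (d : ℝ) * d ≤ 9 := by nlinarith [Nat.cast_nonneg (α := ℝ) d]
    have h₁ : ∀ k l, ‖fderiv ℝ A Q (unitMat k l)‖ ≤ 9 * c := fun k l => by
      refine (norm_le_sum_entries _).trans ?_
      calc ∑ i, ∑ j, |fderiv ℝ A Q (unitMat k l) (i, j)| ≤ ∑ _i : Fin d, ∑ _j : Fin d, c :=
            Finset.sum_le_sum fun i _ => Finset.sum_le_sum fun j _ => hA.bounded Q hQ i j k l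
        _ = d * d * c := by simp [mul_assoc]
        _ ≤ 9 * c := by gcongr
    conv_lhs => rw [eq_sum_unitMat P]
    simp only [map_sum, map_smul]
    calc ‖∑ k, ∑ l, P (k, l) • fderiv ℝ A Q (unitMat k l)‖
        ≤ ∑ k, ∑ l, ‖P (k, l) • fderiv ℝ A Q (unitMat k l)‖ :=
          (norm_sum_le _ _).trans (Finset.sum_le_sum fun k _ => norm_sum_le _ _)
      _ ≤ ∑ _k : Fin d, ∑ _l : Fin d, ‖P‖ * (9 * c) := by
          refine Finset.sum_le_sum fun k _ => Finset.sum_le_sum fun l _ => ?_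
          rw [norm_smul]
          exact mul_le_mul (PiLp.norm_apply_le P (k, l)) (h₁ k l) (norm_nonneg _) (norm_nonneg _)
      _ = d * d * (‖P‖ * (9 * c)) := by simp [mul_assoc]
      _ ≤ 9 * (‖P‖ * (9 * c)) := by gcongr
      _ = 81 * C₁ * deriv (deriv φ) ‖Q‖ * ‖P‖ := by rw [hc]; ring

/-- Monotonicity and a Young type inequality for operators with `φ`-structure, with constants that
depend only on the indices of `φ` and the constants of the structure. -/
theorem exists_monotone_and_young (rm rp C₀ C₁ : ℝ) :
    ∃ K₁ K₂ : ℝ, 0 < K₁ ∧ 0 < K₂ ∧ ∀ d ≤ 3, ∀ φ : ℝ → ℝ, IsUniformlyConvexNFunction φ rm rp →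
      ∀ A : Mat d → Mat d, HasPhiStructure φ C₀ C₁ A →
        (∀ P Q, ‖natF φ P - natF φ Q‖ ^ 2 ≤ K₁ * inner ℝ (A P - A Q) (P - Q)) ∧
        ∀ P Q R, inner ℝ (A P - A Q) (P - R) ≤
          1 / 2 * inner ℝ (A P - A Q) (P - Q) + K₂ * ‖natF φ P - natF φ R‖ ^ 2 := by
  -- The constants must be fixed before `φ` and `A` are given. For inadmissible parameters no such
  -- `φ` and `A` exist and any constants do.
  by_cases hyp : 0 < rm - 1 ∧ 0 < rp - 1 ∧ 0 < C₀ ∧ 0 < C₁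
  swap
  · refine ⟨1, 1, one_pos, one_pos, fun d _ φ hφ A hA => absurd ?_ hyp⟩
    exact ⟨hφ.isPowerLike.a_pos, hφ.isPowerLike.b_pos, hA.C₀_pos, hA.C₁_pos⟩
  obtain ⟨ha, hb, h₀, h₁⟩ := hyp
  set a := rm - 1
  set b := rp - 1
  have p4 : 0 < (4 : ℝ) ^ b := Real.rpow_pos_of_pos (by norm_num) _
  have p2 : 0 < (2 : ℝ) ^ b := Real.rpow_pos_of_pos (by norm_num) _
  have q4 : 0 < (4 : ℝ) ^ ((b + 1) / 2) := Real.rpow_pos_of_pos (by norm_num) _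
  have q2 : 0 < (2 : ℝ) ^ ((b + 1) / 2) := Real.rpow_pos_of_pos (by norm_num) _
  obtain ⟨kA, hkA⟩ : ∃ k, k = C₀ * a * (4 ^ b)⁻¹ / 4 := ⟨_, rfl⟩
  obtain ⟨KA, hKA⟩ : ∃ k, k = 4 * (81 * C₁) * b * 2 ^ b + 8 * (81 * C₁) := ⟨_, rfl⟩
  obtain ⟨kF, hkF⟩ : ∃ k,
    k = min 1 ((b + 1) / 2)⁻¹ * ((a + 1) / 2) * (4 ^ ((b + 1) / 2))⁻¹ / 4 := ⟨_, rfl⟩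
  obtain ⟨KF, hKF⟩ : ∃ k, k = 4 * (2 * ((a + 1) / 2)⁻¹ + 1) * ((b + 1) / 2) * 2 ^ ((b + 1) / 2) +
      8 * (2 * ((a + 1) / 2)⁻¹ + 1) := ⟨_, rfl⟩
  have kA0 : 0 < kA := by rw [hkA]; positivity
  have KA0 : 0 < KA := by rw [hKA]; positivity
  have kF0 : 0 < kF := by rw [hkF]; positivity
  have KF0 : 0 < KF := by rw [hKF]; positivity
  have r : 0 < (4 * (1 + 2 * KA / kA)) ^ b := Real.rpow_pos_of_pos (by positivity) _
  refine ⟨KF ^ 2 / kA, KA * (4 * (1 + 2 * KA / kA) * (4 * (1 + 2 * KA / kA)) ^ b) / kF ^ 2,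
    by positivity, by positivity, fun d hd φ hφ A hA => ?_⟩
  have H : IsPowerLike (deriv φ) (deriv (deriv φ)) a b := hφ.isPowerLike
  have S := hA.hasStructure hd H
  refine monotone_and_young H kA0 KA0 (by positivity) ?_ ?_
    (fun P Q => (natural_distance_equiv H hkF hKF P Q).1)
    (fun P Q => (natural_distance_equiv H hkF hKF P Q).2) (by positivity)
  · rw [hkA]
    exact S.lower_bound H
  · rw [hKA]
    exact S.upper_bound H

/-! ### Integrability in Orlicz classes -/

section Orlicz

variable {d : ℕ} {φ : ℝ → ℝ} {rm rp C₀ C₁ : ℝ} {A : Mat d → Mat d} {Ω : Set (Vec d)}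

theorem IsUniformlyConvexNFunction.nonneg (hφ : IsUniformlyConvexNFunction φ rm rp) {t : ℝ}
    (ht : 0 ≤ t) : 0 ≤ φ t := by
  rw [← hφ.isNFunction.map_zero]
  exact hφ.isNFunction.strictMonoOn.monotoneOn self_mem_Ici ht ht

/-- Convexity gives `φ'(t/2) t/2 ≤ φ(t) - φ(t/2) ≤ φ(t)`, and doubling compares `φ'(t)` with
`φ'(t/2)`. -/
theorem IsUniformlyConvexNFunction.deriv_mul_le (hφ : IsUniformlyConvexNFunction φ rm rp) {t : ℝ}
    (ht : 0 ≤ t) : deriv φ t * t ≤ 2 * 2 ^ (rp - 1) * φ t := by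
  rcases ht.eq_or_lt with rfl | ht
  · simp [hφ.isNFunction.map_zero]
  have H := hφ.isPowerLike
  have ht2 : 0 < t / 2 := by positivity
  have hdiff : DifferentiableAt ℝ φ (t / 2) :=
    (hφ.contDiffOn.differentiableOn (by simp)).differentiableAt (Ioi_mem_nhds ht2)
  have h₁ := hφ.isNFunction.convexOn.deriv_le_slope (x := t / 2) (y := t) (mem_Ici.2 ht2.le)
    (mem_Ici.2 ht.le) (by linarith) hdiff
  rw [slope_def_field, le_div_iff₀ (by linarith)] at h₁
  have h₂ := H.le_mul (l := 2) (by norm_num) ht2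
  rw [mul_div_cancel₀ t (two_ne_zero)] at h₂
  have h₃ := hφ.nonneg ht2.le
  have p2 : 0 < (2 : ℝ) ^ (rp - 1) := Real.rpow_pos_of_pos (by norm_num) _
  calc deriv φ t * t ≤ 2 ^ (rp - 1) * deriv φ (t / 2) * t := by gcongr
    _ = 2 * 2 ^ (rp - 1) * (deriv φ (t / 2) * (t - t / 2)) := by ring
    _ ≤ 2 * 2 ^ (rp - 1) * φ t := by
      gcongr
      linarith

theorem aestronglyMeasurable_phi_norm (hφ : IsUniformlyConvexNFunction φ rm rp)
    {X : Type*} [NormedAddCommGroup X] {μ : Measure (Vec d)}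
    {g : Vec d → X} (hg : AEStronglyMeasurable g μ) :
    AEStronglyMeasurable (fun x => φ ‖g x‖) μ := by
  have hc : Continuous fun x : X => φ ‖x‖ :=
    hφ.isNFunction.continuousOn.comp_continuous continuous_norm fun x => norm_nonneg x
  exact hc.comp_aestronglyMeasurable hg

theorem MemLPhi.integrable (hφ : IsUniformlyConvexNFunction φ rm rp) {X : Type*}
    [NormedAddCommGroup X] {g : Vec d → X} (hg : MemLPhi φ Ω g) :
    Integrable (fun x => φ ‖g x‖) (volume.restrict Ω) := by
  refine ⟨aestronglyMeasurable_phi_norm hφ hg.1, ?_⟩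
  rw [hasFiniteIntegral_iff_ofReal (Eventually.of_forall fun x => hφ.nonneg (norm_nonneg _))]
  exact hg.2

theorem measurable_natF : Measurable (natF (d := d) φ) := by
  unfold natF
  have h₁ : Measurable fun Q : Mat d => deriv φ ‖Q‖ := (measurable_deriv φ).comp measurable_norm
  exact ((h₁.mul measurable_norm).sqrt.div measurable_norm).smul measurable_id

theorem norm_natF_sq (hφ : IsUniformlyConvexNFunction φ rm rp) (Q : Mat d) :
    ‖natF φ Q‖ ^ 2 = deriv φ ‖Q‖ * ‖Q‖ := by
  by_cases hQ : Q = 0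
  · simp [natF, hQ]
  have hp := norm_pos_iff.2 hQ
  have h₁ := hφ.isPowerLike.pos _ hp
  rw [natF, norm_smul, norm_div, norm_norm, div_mul_cancel₀ _ hp.ne', Real.norm_eq_abs, sq_abs,
    Real.sq_sqrt (by positivity)]

theorem memLp_natF (hφ : IsUniformlyConvexNFunction φ rm rp) {P : Vec d → Mat d}
    (hP : MemLPhi φ Ω P) : MemLp (fun x => natF φ (P x)) 2 (volume.restrict Ω) := by
  have hm : AEStronglyMeasurable (fun x => natF φ (P x)) (volume.restrict Ω) :=
    (measurable_natF.comp_aemeasurable hP.1.aemeasurable).aestronglyMeasurable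
  rw [memLp_two_iff_integrable_sq_norm hm]
  refine ((hP.integrable hφ).const_mul (2 * 2 ^ (rp - 1))).mono' (hm.norm.pow 2)
    (Eventually.of_forall fun x => ?_)
  rw [Real.norm_of_nonneg (sq_nonneg _), norm_natF_sq hφ]
  exact hφ.deriv_mul_le (norm_nonneg _)

/-- Young's inequality without the conjugate function: `φ'(|P|) |Q|` is at most `φ'(m) m` with `m`
the larger of the two norms, hence is bounded by a multiple of `φ(|P|) + φ(|Q|)`. -/
theorem integrable_inner (hd : d ≤ 3) (hφ : IsUniformlyConvexNFunction φ rm rp)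
    (hA : HasPhiStructure φ C₀ C₁ A) {P Q : Vec d → Mat d} (hP : MemLPhi φ Ω P)
    (hQ : MemLPhi φ Ω Q) :
    Integrable (fun x => inner ℝ (A (P x)) (Q x)) (volume.restrict Ω) := by
  have H := hφ.isPowerLike
  have S := hA.hasStructure hd H
  have hm : AEStronglyMeasurable (fun x => inner ℝ (A (P x)) (Q x)) (volume.restrict Ω) :=
    (hA.continuous.comp_aestronglyMeasurable hP.1).inner hQ.1
  refine (((hP.integrable hφ).add (hQ.integrable hφ)).const_mul
    (81 * C₁ * (2 * 2 ^ (rp - 1)))).mono' hm (Eventually.of_forall fun x => ?_)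
  have hC := S.c₁_pos
  have p2 : 0 < (2 : ℝ) ^ (rp - 1) := Real.rpow_pos_of_pos (by norm_num) _
  have n₁ := hφ.nonneg (norm_nonneg (P x))
  have n₂ := hφ.nonneg (norm_nonneg (Q x))
  have e₁ := hφ.deriv_mul_le (norm_nonneg (P x))
  have e₂ := hφ.deriv_mul_le (norm_nonneg (Q x))
  simp only [Pi.add_apply]
  by_cases hP0 : P x = 0
  · rw [hP0, hA.map_zero, inner_zero_left, norm_zero]
    rw [hP0] at n₁
    positivity
  have hp := norm_pos_iff.2 hP0
  have key : deriv φ ‖P x‖ * ‖Q x‖ ≤ 2 * 2 ^ (rp - 1) * (φ ‖P x‖ + φ ‖Q x‖) := by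
    rcases le_total ‖Q x‖ ‖P x‖ with hle | hle
    · have := mul_le_mul_of_nonneg_left hle (H.pos _ hp).le
      have : 0 ≤ 2 * 2 ^ (rp - 1) * φ ‖Q x‖ := by positivity
      linarith
    · have h₁ := H.monotoneOn hp (mem_Ioi.2 (hp.trans_le hle)) hle
      have := mul_le_mul_of_nonneg_right h₁ (norm_nonneg (Q x))
      have : 0 ≤ 2 * 2 ^ (rp - 1) * φ ‖P x‖ := by positivity
      linarith
  calc ‖inner ℝ (A (P x)) (Q x)‖ ≤ ‖A (P x)‖ * ‖Q x‖ := norm_inner_le_norm _ _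
    _ ≤ 81 * C₁ * deriv φ ‖P x‖ * ‖Q x‖ := by
      gcongr
      exact S.norm_le H hP0
    _ = 81 * C₁ * (deriv φ ‖P x‖ * ‖Q x‖) := by ring
    _ ≤ 81 * C₁ * (2 * 2 ^ (rp - 1) * (φ ‖P x‖ + φ ‖Q x‖)) := by gcongr
    _ = _ := by ring

theorem memLPhi_of_memLp_top (hb : Bornology.IsBounded Ω)
    (hφ : IsUniformlyConvexNFunction φ rm rp) {X : Type*} [NormedAddCommGroup X] {g : Vec d → X}
    (hg : MemLp g ⊤ (volume.restrict Ω)) : MemLPhi φ Ω g := by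
  refine ⟨hg.1, ?_⟩
  obtain ⟨M, hM⟩ : ∃ M, ∀ᵐ x ∂volume.restrict Ω, ‖g x‖ ≤ M := by
    refine ⟨(eLpNorm g ⊤ (volume.restrict Ω)).toReal, ?_⟩
    filter_upwards [ae_le_eLpNormEssSup (f := g) (μ := volume.restrict Ω)] with x hx
    rw [← eLpNorm_exponent_top] at hx
    rw [← toReal_enorm]
    exact ENNReal.toReal_mono hg.2.ne hx
  calc ∫⁻ x in Ω, ENNReal.ofReal (φ ‖g x‖) ≤ ∫⁻ _ in Ω, ENNReal.ofReal (φ M) := by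
        refine lintegral_mono_ae ?_
        filter_upwards [hM] with x hx
        exact ENNReal.ofReal_le_ofReal (hφ.isNFunction.strictMonoOn.monotoneOn
          (mem_Ici.2 (norm_nonneg _)) (mem_Ici.2 ((norm_nonneg _).trans hx)) hx)
    _ < ⊤ := by
      rw [setLIntegral_const]
      exact ENNReal.mul_lt_top ENNReal.ofReal_lt_top hb.measure_lt_top

theorem mem_W01Phi_of_mem_W01Infty (hb : Bornology.IsBounded Ω)
    (hφ : IsUniformlyConvexNFunction φ rm rp) {v : Vec d → Vec d} (hv : v ∈ W01Infty Ω) :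
    v ∈ W01Phi φ Ω := by
  obtain ⟨G, h₁, h₂, h₃, h₄⟩ := hv
  exact ⟨G, h₁, memLPhi_of_memLp_top hb hφ h₂, memLPhi_of_memLp_top hb hφ h₃, h₄⟩

theorem symPart_sub (P Q : Mat d) : symPart (P - Q) = symPart P - symPart Q := by
  ext p
  simp [symPart]
  ring

theorem continuous_symPart : Continuous (symPart (d := d)) := by
  unfold symPart
  fun_prop

theorem norm_symPart_le (Q : Mat d) : ‖symPart Q‖ ≤ ‖Q‖ := by
  rw [← sq_le_sq₀ (norm_nonneg _) (norm_nonneg _), EuclideanSpace.norm_sq_eq,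
    EuclideanSpace.norm_sq_eq]
  have e : ∑ p : Fin d × Fin d, ‖Q p‖ ^ 2 = ∑ p : Fin d × Fin d, ‖Q (p.2, p.1)‖ ^ 2 :=
    ((Equiv.prodComm (Fin d) (Fin d)).sum_comp fun p => ‖Q p‖ ^ 2).symm
  have e' : ∑ p : Fin d × Fin d, ‖Q p‖ ^ 2 =
      ∑ p : Fin d × Fin d, (‖Q (p.1, p.2)‖ ^ 2 + ‖Q (p.2, p.1)‖ ^ 2) / 2 := by
    rw [← Finset.sum_div, Finset.sum_add_distrib, ← e]
    simp
  rw [e']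
  refine Finset.sum_le_sum fun p _ => ?_
  simp only [symPart, Real.norm_eq_abs, sq_abs]
  nlinarith [sq_nonneg (Q (p.1, p.2) - Q (p.2, p.1))]

theorem memLPhi_symGrad (hΩ : IsOpen Ω) (hφ : IsUniformlyConvexNFunction φ rm rp)
    {v : Vec d → Vec d} (hv : v ∈ W01Phi φ Ω) : MemLPhi φ Ω (symGrad Ω v) := by
  obtain ⟨G, h₁, -, h₃, -⟩ := hv
  have hae := h₁.weakGrad.ae_eq hΩ h₁
  refine ⟨continuous_symPart.comp_aestronglyMeasurable (h₃.1.congr hae.symm), ?_⟩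
  refine lt_of_le_of_lt (lintegral_mono_ae ?_) h₃.2
  filter_upwards [hae] with x hx
  rw [symGrad, hx]
  exact ENNReal.ofReal_le_ofReal (hφ.isNFunction.strictMonoOn.monotoneOn
    (mem_Ici.2 (norm_nonneg _)) (mem_Ici.2 (norm_nonneg _)) (norm_symPart_le _))

/-- `weakGrad` is an arbitrarily chosen representative, so linearity holds only almost everywhere.
-/
theorem symGrad_sub_ae_eq (hΩ : IsOpen Ω) {v w : Vec d → Vec d} {G H : Vec d → Mat d}
    (hv : HasWeakGrad Ω v G) (hw : HasWeakGrad Ω w H) :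
    symGrad Ω (v - w) =ᵐ[volume.restrict Ω] fun x => symGrad Ω v x - symGrad Ω w x := by
  have h₁ := hv.weakGrad.add (hw.weakGrad.const_smul (-1))
  have e : v + (-1 : ℝ) • w = v - w := by
    rw [neg_one_smul, sub_eq_add_neg]
  rw [e] at h₁
  filter_upwards [h₁.weakGrad.ae_eq hΩ h₁] with x hx
  rw [symGrad, hx, symGrad, symGrad, ← symPart_sub]
  simp [sub_eq_add_neg]

end Orlicz

/-! ### Passage to norms and Galerkin orthogonality. -/

theorem eLpNorm_two_le_of_integral_sq_le {α X Y : Type*} [MeasurableSpace α] {μ : Measure α}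
    [NormedAddCommGroup X] [NormedAddCommGroup Y] {f : α → X} {g : α → Y} (hf : MemLp f 2 μ)
    (hg : MemLp g 2 μ) {K : ℝ} (hK : 0 ≤ K)
    (h : ∫ x, ‖f x‖ ^ 2 ∂μ ≤ K * ∫ x, ‖g x‖ ^ 2 ∂μ) :
    eLpNorm f 2 μ ≤ ENNReal.ofReal √K * eLpNorm g 2 μ := by
  rw [hf.eLpNorm_eq_integral_rpow_norm two_ne_zero ENNReal.ofNat_ne_top,
    hg.eLpNorm_eq_integral_rpow_norm two_ne_zero ENNReal.ofNat_ne_top,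
    ← ENNReal.ofReal_mul (Real.sqrt_nonneg K)]
  simp only [ENNReal.toReal_ofNat, Real.rpow_ofNat]
  refine ENNReal.ofReal_le_ofReal ?_
  rw [Real.sqrt_eq_rpow, ← one_div, ← Real.mul_rpow hK (integral_nonneg fun x => sq_nonneg _)]
  exact Real.rpow_le_rpow (integral_nonneg fun x => sq_nonneg _) h (by norm_num)

/-- Galerkin orthogonality: the discretization error is orthogonal to the discretely
divergence-free fields. -/
theorem galerkin_orthogonality {d : ℕ} (hd : d ≤ 3) {φ : ℝ → ℝ} {rm rp C₀ C₁ : ℝ}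
    (hφ : IsUniformlyConvexNFunction φ rm rp) {A : Mat d → Mat d}
    (hA : HasPhiStructure φ C₀ C₁ A) {Ω : Set (Vec d)} {T : Mesh d} (hT : T.IsMeshOf Ω)
    {E : T.CR Ω →ₗ[ℝ] W01Infty Ω} (hE : T.IsSmoothingOperator Ω E)
    {f : (Vec d → Vec d) → ℝ} {u : Vec d → Vec d} {p : Vec d → ℝ}
    (hu : IsWeakSolution φ A Ω f u p) {uh : T.CR Ω} {ph : T.elements → ℝ}
    (huh : T.IsDiscreteSolution Ω A E f uh ph) {wh : T.CR Ω} (hw : wh ∈ T.Zh Ω) :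
    ∫ x in Ω, inner ℝ (A (symGrad Ω u x) - A (symGrad Ω (E uh).1 x)) (symGrad Ω (E wh).1 x) =
      0 := by
  have mem : ∀ v : T.CR Ω, (E v).1 ∈ W01Phi φ Ω := fun v =>
    mem_W01Phi_of_mem_W01Infty hT.isBounded hφ (E v).2
  have hdiv : T.divh wh.1 = fun _ => 0 := funext hw
  have hpw : T.pw (T.divh wh.1) = fun _ => 0 := by rw [hdiv, T.pw_zero]
  have h₁ := hu.momentum _ (mem wh)
  have h₂ := huh.momentum wh
  -- The exact pressure drops out because `E wh` is divergence-free almost everywhere, not merely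
  -- against piecewise constants.
  have e₁ : ∫ x in Ω, p x * weakDiv Ω (E wh).1 x = 0 := by
    have := hE.weakDiv_ae_eq hT wh
    rw [hpw] at this
    refine integral_eq_zero_of_ae ?_
    filter_upwards [this] with x hx
    simp [hx]
  have e₂ : ∫ x in Ω, T.pw ph x * T.pw (T.divh wh.1) x = 0 := by simp [hpw]
  rw [e₁, sub_zero] at h₁
  rw [e₂, sub_zero] at h₂
  have hDw := memLPhi_symGrad hT.isOpen hφ (mem wh)
  simp only [inner_sub_left]
  rw [integral_sub
    (integrable_inner hd hφ hA (memLPhi_symGrad hT.isOpen hφ hu.velocity_mem) hDw)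
    (integrable_inner hd hφ hA (memLPhi_symGrad hT.isOpen hφ (mem uh)) hDw), h₁, h₂, sub_self]

end NonlinearStokes

end

/-! ### Quasi-optimality in the natural distance. -/

open NonlinearStokes

theorem theorem4p3 (rm rp C₀ C₁ : ℝ) :
    ∃ c : ℝ≥0, ∀ (d : ℕ), d = 2 ∨ d = 3 →
      ∀ (φ : ℝ → ℝ), NonlinearStokes.IsUniformlyConvexNFunction φ rm rp →
      ∀ (A : NonlinearStokes.Mat d → NonlinearStokes.Mat d),
        NonlinearStokes.HasPhiStructure φ C₀ C₁ A →
      ∀ (Ω : Set (NonlinearStokes.Vec d)) (T : NonlinearStokes.Mesh d), T.IsMeshOf Ω →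
      ∀ (E : T.CR Ω →ₗ[ℝ] NonlinearStokes.W01Infty Ω),
        T.IsSmoothingOperator Ω E →
      ∀ (f : (NonlinearStokes.Vec d → NonlinearStokes.Vec d) → ℝ),
        NonlinearStokes.IsDualFunctional φ Ω f →
      ∀ (u : NonlinearStokes.Vec d → NonlinearStokes.Vec d) (p : NonlinearStokes.Vec d → ℝ),
        NonlinearStokes.IsWeakSolution φ A Ω f u p →
      ∀ (uh : T.CR Ω) (ph : T.elements → ℝ), T.IsDiscreteSolution Ω A E f uh ph →
        NonlinearStokes.natDist φ Ω u (E uh).1 ≤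
          c * ⨅ vh ∈ T.Zh Ω, NonlinearStokes.natDist φ Ω u (E vh).1 := by
  obtain ⟨K₁, K₂, hK₁, hK₂, hK⟩ := NonlinearStokes.exists_monotone_and_young rm rp C₀ C₁
  have hK0 : 0 < K₁ * (2 * K₂) := by positivity
  -- `K₁` comes from monotonicity and `2 * K₂` from absorbing half of the monotone term; the root
  -- passes from squared norms to norms.
  refine ⟨(√(K₁ * (2 * K₂))).toNNReal, ?_⟩
  intro d hd φ hφ A hA Ω T hT E hE f _ u p hu uh ph huh
  have hd3 : d ≤ 3 := by omega
  obtain ⟨hmono, hyoung⟩ := hK d hd3 φ hφ A hA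
  have hc0 : ((√(K₁ * (2 * K₂))).toNNReal : ℝ≥0∞) ≠ 0 := by
    simpa using hK0
  -- A nonzero finite factor can be moved inside an infimum, so a single `vh` can be treated.
  simp only [ENNReal.mul_iInf_of_ne hc0 ENNReal.coe_ne_top]
  refine le_iInf₂ fun vh hvh => ?_
  have huZ : uh ∈ T.Zh Ω := Mesh.mem_Zh_of_mass hT hE uh huh.mass
  have hwZ : uh - vh ∈ T.Zh Ω := fun K => by
    have h₁ := huZ K
    have h₂ := hvh K
    simp only [Mesh.divh] at h₁ h₂ ⊢
    simp [Finset.sum_sub_distrib, h₁, h₂]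
  have horth := galerkin_orthogonality hd3 hφ hA hT hE hu huh hwZ
  have mem : ∀ v : T.CR Ω, MemLPhi φ Ω (symGrad Ω (E v).1) := fun v =>
    memLPhi_symGrad hT.isOpen hφ (mem_W01Phi_of_mem_W01Infty hT.isBounded hφ (E v).2)
  have hP : MemLPhi φ Ω (symGrad Ω u) := memLPhi_symGrad hT.isOpen hφ hu.velocity_mem
  have hQ := mem uh
  have hR := mem vh
  obtain ⟨_, hGu, -⟩ := (E uh).2
  obtain ⟨_, hGv, -⟩ := (E vh).2
  have hW : symGrad Ω (E (uh - vh)).1 =ᵐ[volume.restrict Ω]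
      fun x => symGrad Ω (E uh).1 x - symGrad Ω (E vh).1 x := by
    rw [map_sub]
    exact symGrad_sub_ae_eq hT.isOpen hGu hGv
  set P := symGrad Ω u
  set Q := symGrad Ω (E uh).1
  set R := symGrad Ω (E vh).1
  have int : ∀ {X Y : Vec d → Mat d}, MemLPhi φ Ω X → MemLPhi φ Ω Y →
      Integrable (fun x => inner ℝ (A (P x) - A (Q x)) (X x - Y x)) (volume.restrict Ω) := by
    intro X Y hX hY
    simp only [inner_sub_left, inner_sub_right]
    exact ((integrable_inner hd3 hφ hA hP hX).sub (integrable_inner hd3 hφ hA hQ hX)).sub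
      ((integrable_inner hd3 hφ hA hP hY).sub (integrable_inner hd3 hφ hA hQ hY))
  -- The second arguments differ by `Q - R`, the symmetric gradient of `E (uh - vh)`, which is
  -- annihilated by orthogonality.
  have heq : ∫ x in Ω, inner ℝ (A (P x) - A (Q x)) (P x - Q x) =
      ∫ x in Ω, inner ℝ (A (P x) - A (Q x)) (P x - R x) := by
    have h₁ : ∫ x in Ω, inner ℝ (A (P x) - A (Q x)) (Q x - R x) = 0 := by
      rw [← horth]
      refine integral_congr_ae ?_
      filter_upwards [hW] with x hx
      rw [hx]
    have h₂ : ∀ x, inner ℝ (A (P x) - A (Q x)) (P x - R x) =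
        inner ℝ (A (P x) - A (Q x)) (P x - Q x) + inner ℝ (A (P x) - A (Q x)) (Q x - R x) :=
      fun x => by rw [← inner_add_right, sub_add_sub_cancel]
    simp only [h₂]
    rw [integral_add (int hP hQ) (int hQ hR), h₁, add_zero]
  have mFQ := (memLp_natF hφ hP).sub (memLp_natF hφ hQ)
  have mFR := (memLp_natF hφ hP).sub (memLp_natF hφ hR)
  have iFQ : Integrable (fun x => ‖natF φ (P x) - natF φ (Q x)‖ ^ 2) (volume.restrict Ω) :=
    (memLp_two_iff_integrable_sq_norm mFQ.1).1 mFQ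
  have iFR : Integrable (fun x => ‖natF φ (P x) - natF φ (R x)‖ ^ 2) (volume.restrict Ω) :=
    (memLp_two_iff_integrable_sq_norm mFR.1).1 mFR
  have b₁ : ∫ x in Ω, ‖natF φ (P x) - natF φ (Q x)‖ ^ 2 ≤
      K₁ * ∫ x in Ω, inner ℝ (A (P x) - A (Q x)) (P x - Q x) := by
    rw [← integral_const_mul]
    exact integral_mono iFQ ((int hP hQ).const_mul K₁) fun x => hmono (P x) (Q x)
  have b₂ : ∫ x in Ω, inner ℝ (A (P x) - A (Q x)) (P x - R x) ≤
      1 / 2 * (∫ x in Ω, inner ℝ (A (P x) - A (Q x)) (P x - Q x)) +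
        K₂ * ∫ x in Ω, ‖natF φ (P x) - natF φ (R x)‖ ^ 2 := by
    rw [← integral_const_mul, ← integral_const_mul,
      ← integral_add ((int hP hQ).const_mul _) (iFR.const_mul _)]
    exact integral_mono (int hP hR) (((int hP hQ).const_mul _).add (iFR.const_mul _))
      fun x => hyoung (P x) (Q x) (R x)
  refine eLpNorm_two_le_of_integral_sq_le mFQ mFR hK0.le ?_
  -- Both sides now contain the same finite integral, and half of it is absorbed.
  rw [← heq] at b₂
  calc ∫ x in Ω, ‖natF φ (P x) - natF φ (Q x)‖ ^ 2
      ≤ K₁ * ∫ x in Ω, inner ℝ (A (P x) - A (Q x)) (P x - Q x) := b₁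
    _ ≤ K₁ * (2 * K₂ * ∫ x in Ω, ‖natF φ (P x) - natF φ (R x)‖ ^ 2) :=
      mul_le_mul_of_nonneg_left (by linarith) hK₁.le
    _ = _ := by rw [← mul_assoc]; rfl
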